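/- Let $\mathbb G$ be a finite quantum group, i.e. let $A=F(\mathbb G)$ be a finite-dimensional (unital, complex) $\mathrm C^*$-algebra with a Hopf algebra structure $(\Delta,\varepsilon,S)$ such that $\Delta(a^*)=\Delta(a)^*$, where $(a\otimes b)^*=a^*\otimes b^*$. A state on $A$ is a positive linear functional $\nu:A\to\mathbb C$ with $\nu(1)=1$. Let $\pi=\int_{\mathbb G}$ be the Haar state, i.e. the state with $(\pi\otimes I)\Delta(a)=\pi(a)1=(I\otimes\pi)\Delta(a)$ for all $a\in A$. The map $\mathcal F:A\to A^*$, $\mathcal F(a)(b)=\pi(ba)$, is bijective. Put $\|a\|_1=\pi(|a|)$ with $|a|=(a^*a)^{1/2}$, and define the quantum total variation distance of $\mu\in A^*$ to $\pi$ by $$\|\mu-\pi\|:=\tfrac12\,\|\mathcal F^{-1}(\mu-\pi)\|_1 .$$ Convolution on $A^*$ is $\mu\star\nu=(\mu\otimes\nu)\circ\Delta$, with powers $\nu^{\star k}$ and $\nu^{\star 0}=\varepsilon$. A corepresentation on a vector space $V$ is a linear map $\kappa:V\to V\otimes A$ with $(\kappa\otimes I)\kappa=(I\otimes\Delta)\kappa$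 and $(I\otimes\varepsilon)\kappa=I$. It is irreducible if $V\neq0$ and no subspace $W$ other than $0$ and $V$ satisfies $\kappa(W)\subseteq W\otimes A$. If $V$ is a Hilbert space, it is unitary if $\langle\kappa(v),\kappa(u)\rangle_A=\langle v,u\rangle 1$ for all $u,v\in V$, where $\langle v\otimes a,w\otimes b\rangle_A=\langle v,w\rangle a^*b$. Two corepresentations $\kappa,\kappa_0$ on $V,V_0$ are equivalent if there is a linear isomorphism $T:V\to V_0$ with $\kappa_0T=(T\otimes I)\kappa$. Let $(\kappa_\alpha)_{\alpha\in\operatorname{Irr}(\mathbb G)}$, with $\kappa_\alpha$ on a finite-dimensional Hilbert space $V_\alpha$ of dimension $d_\alpha$, be a complete family of pairwise inequivalent irreducible unitary corepresentations; the set $\operatorname{Irr}(\mathbb G)$ is finite. Let $\tau\in\operatorname{Irr}(\mathbb G)$ be the class of the trivial corepresentation $c\mapsto c\otimes 1$ on $\mathbb C$. Let $\overline{\kappa}_\alpha:\overline{V_\alpha}\to\overline{V_\alpha}\otimes A$ be the conjugate of $\kappa_\alpha$ on the conjugate Hilbert space: $\overline{\kappa}_\alpha(\overline v)=\sum_i\overline{v_i}\otimes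 a_i^*$ if $\kappa_\alpha(v)=\sum_i v_i\otimes a_i$. The Fourier transform of $\nu\in A^*$ at $\alpha$ is $$\widehat\nu(\alpha)=(I\otimes\nu)\circ\overline{\kappa}_\alpha\in L(\overline{V_\alpha}).$$ Quantum Diaconis–Shahshahani Upper Bound Lemma: for every state $\nu$ on $A$ and every integer $k\ge0$, $$\|\nu^{\star k}-\pi\|^2\le\frac14\sum_{\alpha\in\operatorname{Irr}(\mathbb G)\setminus\{\tau\}}d_\alpha\operatorname{Tr}\left[(\widehat\nu(\alpha)^*)^k\,\widehat\nu(\alpha)^k\right].$$ -/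

import Mathlib

open scoped TensorProduct ComplexConjugate ComplexOrder InnerProductSpace

noncomputable section

/-- `A` is the algebra of functions `F(𝔾)` on a finite quantum group `𝔾`: a finite-dimensional
(unital, complex) C⋆-algebra together with a Hopf algebra structure such that
`Δ(a⋆) = Δ(a)⋆`, where `(a ⊗ b)⋆ = a⋆ ⊗ b⋆`. -/
class FiniteQuantumGroup (A : Type*) [CStarAlgebra A] extends Coalgebra ℂ A where
  finiteDimensional : FiniteDimensional ℂ A
  counit_one : counit (1 : A) = 1
  counit_mul : ∀ a b : A, counit (a * b) = counit a * counit b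
  comul_one : comul (1 : A) = 1
  comul_mul : ∀ a b : A, comul (a * b) = comul a * comul b
  comul_star : ∀ a : A, comul (star a) = star (comul a)
  antipode : A →ₗ[ℂ] A
  mul_antipode_rTensor_comul :
    LinearMap.mul' ℂ A ∘ₗ antipode.rTensor A ∘ₗ comul = Algebra.linearMap ℂ A ∘ₗ counit
  mul_antipode_lTensor_comul :
    LinearMap.mul' ℂ A ∘ₗ antipode.lTensor A ∘ₗ comul = Algebra.linearMap ℂ A ∘ₗ counit

attribute [instance] FiniteQuantumGroup.finiteDimensional

/-- The underlying Hopf algebra of a finite quantum group, in the sense of Mathlib. -/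
instance FiniteQuantumGroup.toHopfAlgebra (A : Type*) [CStarAlgebra A]
    [FiniteQuantumGroup A] : HopfAlgebra ℂ A where
  toAlgebra := NormedAlgebra.toAlgebra
  toCoalgebra := FiniteQuantumGroup.toCoalgebra
  counit_one := FiniteQuantumGroup.counit_one
  mul_compr₂_counit := by ext a b; exact FiniteQuantumGroup.counit_mul a b
  comul_one := FiniteQuantumGroup.comul_one
  mul_compr₂_comul := by ext a b; exact FiniteQuantumGroup.comul_mul a b
  antipode := FiniteQuantumGroup.antipode
  mul_antipode_rTensor_comul := FiniteQuantumGroup.mul_antipode_rTensor_comul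
  mul_antipode_lTensor_comul := FiniteQuantumGroup.mul_antipode_lTensor_comul

namespace FiniteQuantumGroup

section States

variable {A : Type*} [CStarAlgebra A]

/-- `φ` is a state on `A`, i.e. an element of `M_p(𝔾)`: a positive linear functional with
`φ(1) = 1` (the inequality is the one in `ℂ`: the value is real and nonnegative). -/
structure IsState (φ : A →ₗ[ℂ] ℂ) : Prop where
  nonneg : ∀ a : A, 0 ≤ φ (star a * a)
  map_one : φ 1 = 1

/-- The map `𝓕 : F(𝔾) → ℂ𝔾`, `𝓕(a)(b) = ∫ b a`, where `∫` is the functional `h`. -/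
def vanDaele (h : A →ₗ[ℂ] ℂ) (a : A) : A →ₗ[ℂ] ℂ :=
  h ∘ₗ LinearMap.mulRight ℂ a

/-- The `1`-norm `‖a‖₁ = ∫ |a|` on `F(𝔾)`, where `|a| = (a⋆ a)^{1/2}` is given by the continuous
functional calculus and `∫` is the functional `h`. -/
def oneNorm (h : A →ₗ[ℂ] ℂ) (a : A) : ℝ :=
  (h (cfc Real.sqrt (star a * a))).re

/-- The total variation distance `‖μ - π‖ = ½ ‖𝓕⁻¹(μ - π)‖₁` of a functional `μ` to `π`.
(`Function.invFun` is the inverse map wherever `vanDaele π` is bijective.) -/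
def totalVariation (μ π : A →ₗ[ℂ] ℂ) : ℝ :=
  1 / 2 * oneNorm π (Function.invFun (vanDaele π) (μ - π))

variable [FiniteQuantumGroup A]

/-- `h` is the Haar state: a state with `(h ⊗ I) Δ(a) = h(a) 1 = (I ⊗ h) Δ(a)` for all `a`. -/
structure IsHaarState (h : A →ₗ[ℂ] ℂ) : Prop where
  isState : IsState h
  right_invariant : ∀ a : A,
    TensorProduct.lid ℂ A (h.rTensor A (Coalgebra.comul a)) = h a • (1 : A)
  left_invariant : ∀ a : A,
    TensorProduct.rid ℂ A (h.lTensor A (Coalgebra.comul a)) = h a • (1 : A)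

/-- The convolution power `ν^{⋆ k}`, for the convolution `μ ⋆ ν = (μ ⊗ ν) ∘ Δ`; `ν^{⋆ 0} = ε`. -/
def convPow (ν : A →ₗ[ℂ] ℂ) : ℕ → (A →ₗ[ℂ] ℂ)
  | 0 => Coalgebra.counit
  | k + 1 => LinearMap.mul' ℂ ℂ ∘ₗ TensorProduct.map (convPow ν k) ν ∘ₗ Coalgebra.comul

end States

section Conj

/-- The conjugate vector space `V̄` of a complex inner product space `V`. -/
def ConjSpace (V : Type*) : Type _ := V

variable (V : Type*) [NormedAddCommGroup V] [InnerProductSpace ℂ V]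

instance : NormedAddCommGroup (ConjSpace V) := inferInstanceAs (NormedAddCommGroup V)

/-- The scalar multiplication of `V̄` is `c • v̄ = (c̄ • v)‾`. -/
instance : Module ℂ (ConjSpace V) := Module.compHom V (starRingEnd ℂ)

instance : NormedSpace ℂ (ConjSpace V) where
  norm_smul_le c v := by
    have h := norm_smul_le (conj c) (show V from v)
    rwa [RCLike.norm_conj] at h

/-- The canonical conjugate-linear isomorphism `v ↦ v̄`. -/
def toConj : V ≃ₗ⋆[ℂ] ConjSpace V where
  toFun v := v
  invFun v := v
  map_add' _ _ := rfl
  map_smul' c v := by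
    change c • v = conj (conj c) • v
    rw [Complex.conj_conj]
  left_inv _ := rfl
  right_inv _ := rfl

/-- The inner product of `V̄` is `⟪u̅, v̅⟫ = ⟪v, u⟫`, so that orthonormal bases of `V` give
orthonormal bases of `V̄`. -/
instance : InnerProductSpace ℂ (ConjSpace V) where
  inner u v := ⟪(toConj V).symm v, (toConj V).symm u⟫_ℂ
  norm_sq_eq_re_inner v := norm_sq_eq_re_inner (𝕜 := ℂ) ((toConj V).symm v)
  conj_inner_symm u v := inner_conj_symm ((toConj V).symm v) ((toConj V).symm u)
  add_left _ _ _ := inner_add_right _ _ _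
  smul_left u v c := inner_smul_right ((toConj V).symm v) ((toConj V).symm u) (conj c)

instance [FiniteDimensional ℂ V] : FiniteDimensional ℂ (ConjSpace V) :=
  Module.Finite.of_surjective (toConj V).toLinearMap (toConj V).surjective

end Conj

/-- The `F(𝔾)`-valued sesquilinear inner product on `V ⊗ F(𝔾)` determined by
`⟨v ⊗ a, w ⊗ b⟩ = ⟪v, w⟫ a⋆ b`. -/
def innerA (A V : Type*) [CStarAlgebra A] [NormedAddCommGroup V] [InnerProductSpace ℂ V] :
    V ⊗[ℂ] A →ₗ⋆[ℂ] V ⊗[ℂ] A →ₗ[ℂ] A :=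
  (TensorProduct.map₂ (innerₛₗ ℂ)
    ((LinearMap.mul ℂ A).comp (starLinearEquiv ℂ (A := A)).toLinearMap)).compr₂ₛₗ
      (TensorProduct.lid ℂ A).toLinearMap

theorem innerA_tmul {A V : Type*} [CStarAlgebra A] [NormedAddCommGroup V]
    [InnerProductSpace ℂ V] (v w : V) (a b : A) :
    innerA A V (v ⊗ₜ a) (w ⊗ₜ b) = ⟪v, w⟫_ℂ • (star a * b) := by
  simp [innerA]

/-- A (co)representation of a finite quantum group on a complex vector space `V`. -/
structure Corepresentation (A : Type*) [CStarAlgebra A] [FiniteQuantumGroup A]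
    (V : Type*) [AddCommGroup V] [Module ℂ V] where
  /-- The coaction `κ : V → V ⊗ F(𝔾)`. -/
  map : V →ₗ[ℂ] V ⊗[ℂ] A
  /-- `(κ ⊗ I) ∘ κ = (I ⊗ Δ) ∘ κ`. -/
  coassoc : ∀ v : V, TensorProduct.assoc ℂ V A A (map.rTensor A (map v)) =
    (Coalgebra.comul (R := ℂ) (A := A)).lTensor V (map v)
  /-- `(I ⊗ ε) ∘ κ = I`. -/
  counit : ∀ v : V, TensorProduct.rid ℂ V
    ((Coalgebra.counit (R := ℂ) (A := A)).lTensor V (map v)) = v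

namespace Corepresentation

variable {A : Type*} [CStarAlgebra A] [FiniteQuantumGroup A]

section Algebraic

variable {V W : Type*} [AddCommGroup V] [Module ℂ V] [AddCommGroup W] [Module ℂ W]

/-- `κ` is irreducible: `V ≠ 0`, and the only subspaces `W` with `κ(W) ⊆ W ⊗ F(𝔾)` are `0`
and `V`. -/
def IsIrreducible (κ : Corepresentation A V) : Prop :=
  Nontrivial V ∧ ∀ W : Submodule ℂ V,
    (∀ w ∈ W, κ.map w ∈ LinearMap.range (W.subtype.rTensor A)) → W = ⊥ ∨ W = ⊤

/-- `κ` and `κ₀` are equivalent: there is an invertible intertwiner. -/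
def Equivalent (κ : Corepresentation A V) (κ₀ : Corepresentation A W) : Prop :=
  ∃ T : V ≃ₗ[ℂ] W, ∀ v : V, κ₀.map (T v) = T.toLinearMap.rTensor A (κ.map v)

/-- The trivial corepresentation `τ(c) = c ⊗ 1` on `ℂ`. -/
def trivial (A : Type*) [CStarAlgebra A] [FiniteQuantumGroup A] : Corepresentation A ℂ where
  map := (TensorProduct.mk ℂ ℂ A).flip 1
  coassoc v := by simp [Algebra.TensorProduct.one_def]
  counit v := by simp

end Algebraic

section Hilbert

variable {V : Type*} [NormedAddCommGroup V] [InnerProductSpace ℂ V]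

/-- `κ` is unitary: `⟨κ(v), κ(u)⟩ = ⟪v, u⟫ 1` for all `v, u ∈ V`. -/
def IsUnitary (κ : Corepresentation A V) : Prop :=
  ∀ v u : V, innerA A V (κ.map v) (κ.map u) = ⟪v, u⟫_ℂ • (1 : A)

/-- The conjugate `κ̄ : V̄ → V̄ ⊗ F(𝔾)` of `κ`: if `κ(v) = ∑ᵢ vᵢ ⊗ aᵢ`, then
`κ̄(v̄) = ∑ᵢ v̄ᵢ ⊗ aᵢ⋆`. -/
def conjMap (κ : Corepresentation A V) : ConjSpace V →ₗ[ℂ] ConjSpace V ⊗[ℂ] A :=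
  (TensorProduct.map (toConj V).toLinearMap (starLinearEquiv ℂ (A := A)).toLinearMap).comp
    (κ.map.comp (toConj V).symm.toLinearMap)

/-- The Fourier transform `φ̂(κ) = (I ⊗ φ) ∘ κ̄ ∈ L(V̄)` of a functional `φ` on `F(𝔾)`. -/
def fourier (φ : A →ₗ[ℂ] ℂ) (κ : Corepresentation A V) : ConjSpace V →ₗ[ℂ] ConjSpace V :=
  (TensorProduct.rid ℂ (ConjSpace V)).toLinearMap ∘ₗ φ.lTensor (ConjSpace V) ∘ₗ κ.conjMap

end Hilbert

/-- The family `(κ_α)_{α ∈ ι}` is a complete family of representatives for `Irr(𝔾)`: its members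
are irreducible and unitary, they are pairwise inequivalent, and every irreducible unitary
corepresentation on a (finite-dimensional) Hilbert space is equivalent to one of them. -/
structure IsIrr {ι : Type*} {V : ι → Type*} [∀ α, NormedAddCommGroup (V α)]
    [∀ α, InnerProductSpace ℂ (V α)] (κ : ∀ α, Corepresentation A (V α)) : Prop where
  irreducible : ∀ α, (κ α).IsIrreducible
  unitary : ∀ α, (κ α).IsUnitary
  inequivalent : ∀ α β, (κ α).Equivalent (κ β) → α = β
  exhaustive : ∀ (n : ℕ) (κ₀ : Corepresentation A (EuclideanSpace ℂ (Fin n))),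
    κ₀.IsIrreducible → κ₀.IsUnitary → ∃ α, (κ α).Equivalent κ₀

end Corepresentation

end FiniteQuantumGroup

end

/-!
Write `f = ν^{⋆ k} - π = 𝓕(a)`. By Cauchy–Schwarz `‖a‖₁² ≤ π(a⋆ a)`, and the right-hand side is
computed by Parseval's identity in the Hilbert space `A` with inner product `π(a⋆ b)`. The
coefficients `ρᵢⱼ` of the irreducible unitary corepresentations, scaled by `√d_α`, form an
orthonormal basis of it, so `π(a⋆ a) = ∑_α d_α ∑ᵢⱼ |f(ρᵢⱼ⋆)|²` (`IsIrr.plancherel`). For the trivial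
corepresentation `f(ρᵢⱼ⋆)` vanishes because `f(1) = 0`; for the others `π(ρᵢⱼ⋆) = 0` and
`ν^{⋆ k}(ρᵢⱼ⋆)` is the `(i, j)` entry of `ν̂(α)ᵏ` (`fourier_pow_apply`), so the inner sum is
`Tr((ν̂(α)⋆)ᵏ ν̂(α)ᵏ)` (`re_trace_fourier_pow`).

That the basis needs no normalisation besides `√d_α` rests on the Haar state being a trace. It is
moreover faithful, which makes `𝓕` bijective. Both facts follow from an explicit formula
(`IsHaarState.eq_regularTrace`): `π(a) = Tr(L_a) / dim A`, where `L_a` is left multiplication by `a`.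
Indeed this functional `τ` is visibly tracial, and it is a faithful state since the eigenvalues of
`L_{a⋆ a}` are nonnegative. The isomorphism `x ⊗ y ↦ Δ(x)(1 ⊗ y)` from `A ⊗ A` with action on the
first factor to `A ⊗ A` with the diagonal action shows `τ ⋆ τ = τ` (`conv_regularTrace_self`), and a
faithful idempotent state is left invariant (`slice_comul_eq_of_conv_self`).

With traciality, Schur's lemma gives the orthogonality relations
(`Corepresentation.haar_star_coeff_mul_coeff`), which also bound the number of irreducible
corepresentations. The span of the coefficients is everything (`IsIrr.span_coeff_eq_top`), because a
minimal invariant subspace of its orthogonal complement would be irreducible and thus contained in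
the span.
-/

open scoped TensorProduct ComplexConjugate ComplexOrder InnerProductSpace

noncomputable section

namespace FiniteQuantumGroup

/-! ### The regular trace of a finite-dimensional C⋆-algebra -/

section RegularTrace
variable {A : Type*} [CStarAlgebra A]

/-- The normalised trace `a ↦ Tr(L_a) / dim A` of the left regular representation
`L_a b = a b` of `A` on itself. -/
def regularTrace (A : Type*) [CStarAlgebra A] : A →ₗ[ℂ] ℂ :=
  (Module.finrank ℂ A : ℂ)⁻¹ • LinearMap.trace ℂ A ∘ₗ LinearMap.mul ℂ A

theorem regularTrace_apply (a : A) :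
    regularTrace A a = (Module.finrank ℂ A : ℂ)⁻¹ * LinearMap.trace ℂ A (LinearMap.mulLeft ℂ a) :=
  rfl

theorem regularTrace_mul_comm (a b : A) : regularTrace A (a * b) = regularTrace A (b * a) := by
  simp only [regularTrace_apply, LinearMap.mulLeft_mul]
  congr 1
  exact LinearMap.trace_mul_comm ℂ (LinearMap.mulLeft ℂ a) (LinearMap.mulLeft ℂ b)

theorem regularTrace_one [FiniteDimensional ℂ A] [Nontrivial A] : regularTrace A 1 = 1 := by
  have : (Module.finrank ℂ A : ℂ) ≠ 0 := by exact_mod_cast Module.finrank_pos.ne'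
  simp [regularTrace_apply, this]

/-- The eigenvalues of `b ↦ a⋆ a b` lie in the spectrum of the positive element `a⋆ a`. -/
theorem nonneg_of_hasEigenvalue_mulLeft {a : A} {c : ℂ}
    (h : Module.End.HasEigenvalue (LinearMap.mulLeft ℂ (star a * a)) c) : 0 ≤ c := by
  obtain ⟨v, hv⟩ := h.exists_hasEigenvector
  have hc : c ∈ spectrum ℂ (star a * a) := by
    rw [spectrum.mem_iff]
    intro hu
    apply hv.2
    have h1 : (algebraMap ℂ A c - star a * a) * v = 0 := by
      have := hv.apply_eq_smul
      rw [sub_mul, ← Algebra.smul_def, ← this, LinearMap.mulLeft_apply, sub_self]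
    simpa using (hu.mul_right_eq_zero).1 h1
  have hr := (IsSelfAdjoint.star_mul_self a).spectrumRestricts.apply_mem hc
  have h2 := spectrum_star_mul_self_nonneg _ hr
  rw [← (IsSelfAdjoint.star_mul_self a).spectrumRestricts.rightInvOn hc]
  simpa using h2

theorem trace_eq_sum_roots {V : Type*} [AddCommGroup V] [Module ℂ V] [FiniteDimensional ℂ V]
    (f : V →ₗ[ℂ] V) : LinearMap.trace ℂ V f = f.charpoly.roots.sum := by
  classical
  let b := Module.finBasis ℂ V
  rw [LinearMap.trace_eq_matrix_trace ℂ b, Matrix.trace_eq_sum_roots_charpoly,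
    LinearMap.charpoly_toMatrix]

variable [FiniteDimensional ℂ A]

theorem roots_charpoly_mulLeft_nonneg {a : A} {c : ℂ}
    (h : c ∈ (LinearMap.mulLeft ℂ (star a * a)).charpoly.roots) : 0 ≤ c := by
  apply nonneg_of_hasEigenvalue_mulLeft (a := a)
  rw [Module.End.hasEigenvalue_iff_isRoot_charpoly]
  exact Polynomial.isRoot_of_mem_roots h

theorem regularTrace_star_mul_self_nonneg (a : A) : 0 ≤ regularTrace A (star a * a) := by
  rw [regularTrace_apply, trace_eq_sum_roots]
  refine mul_nonneg ?_ (Multiset.sum_nonneg fun c hc => roots_charpoly_mulLeft_nonneg hc)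
  rw [← Complex.ofReal_natCast, ← Complex.ofReal_inv]
  exact Complex.zero_le_real.2 (by positivity)

/-- If the nonnegative eigenvalues of `L_{a⋆ a}` add up to `0`, they all vanish, so the self-adjoint
element `a⋆ a` has spectral radius `0`. -/
theorem regularTrace_faithful {a : A} (h : regularTrace A (star a * a) = 0) : a = 0 := by
  nontriviality A
  have hd : (Module.finrank ℂ A : ℂ) ≠ 0 := by exact_mod_cast Module.finrank_pos.ne'
  rw [regularTrace_apply, trace_eq_sum_roots, mul_eq_zero,
    or_iff_right (inv_ne_zero hd)] at h
  set x := star a * a with hx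
  have hroots : ∀ c ∈ (LinearMap.mulLeft ℂ x).charpoly.roots, c = 0 :=
    fun c hc => Multiset.all_zero_of_le_zero_le_of_sum_eq_zero
      (fun c hc => roots_charpoly_mulLeft_nonneg hc) h c hc
  have hspec : ∀ c ∈ spectrum ℂ x, c = 0 := by
    intro c hc
    apply hroots
    -- Conversely every point of the spectrum of `x` is an eigenvalue of `L_x`: a right inverse of
    -- `L_{c - x}` gives a right inverse of `c - x`, which is two-sided in a finite-dimensional algebra.
    rw [Polynomial.mem_roots (LinearMap.charpoly_monic _).ne_zero,
      ← Module.End.hasEigenvalue_iff_isRoot_charpoly, Module.End.hasEigenvalue_iff_mem_spectrum]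
    rw [spectrum.mem_iff] at hc ⊢
    intro hu
    apply hc
    have := IsNoetherianRing.of_finite ℂ A
    obtain ⟨g, hg⟩ := hu.exists_right_inv
    have h1 : (algebraMap ℂ A c - x) * g 1 = 1 := by
      have := LinearMap.congr_fun hg 1
      simpa [sub_mul, Algebra.smul_def] using this
    exact IsUnit.of_mul_eq_one _ h1
  have hsa : IsSelfAdjoint x := IsSelfAdjoint.star_mul_self a
  have h0 : spectralRadius ℂ x = 0 := by
    simp only [spectralRadius, ENNReal.iSup_eq_zero]
    intro c hc
    simp [hspec c hc]
  rw [hsa.spectralRadius_eq_nnnorm] at h0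
  have hx0 : x = 0 := by simpa using h0
  exact CStarRing.star_mul_self_eq_zero_iff a |>.1 hx0
end RegularTrace

/-- A positive definite Hermitian form on a bare vector space, as coordinates in Euclidean space.
This transports Hilbert space theory to `A` without putting a second norm on it. -/
theorem exists_linearEquiv_euclideanSpace {V : Type*} [AddCommGroup V] [Module ℂ V]
    [FiniteDimensional ℂ V] (c : InnerProductSpace.Core ℂ V) :
    ∃ (n : ℕ) (Φ : V ≃ₗ[ℂ] EuclideanSpace ℂ (Fin n)), ∀ x y, ⟪Φ x, Φ y⟫_ℂ = c.inner x y := by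
  let := c.toNormedAddCommGroup
  let : InnerProductSpace ℂ V := InnerProductSpace.ofCore c.toCore
  exact ⟨_, (stdOrthonormalBasis ℂ V).repr.toLinearEquiv,
    fun x y => (stdOrthonormalBasis ℂ V).repr.inner_map_map x y⟩
/-! ### The inner product of a faithful state -/

section StateForm
variable {A : Type*} [CStarAlgebra A]

/-- States are Hermitian: apply positivity to `1 + a` and `1 + i a`. -/
theorem IsState.map_star {φ : A →ₗ[ℂ] ℂ} (hφ : IsState φ) (a : A) :
    φ (star a) = conj (φ a) := by
  have h1 := (Complex.nonneg_iff.1 (hφ.nonneg (1 + a))).2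
  have h2 := (Complex.nonneg_iff.1 (hφ.nonneg (1 + Complex.I • a))).2
  have h3 := (Complex.nonneg_iff.1 (hφ.nonneg a)).2
  simp only [star_add, star_one, star_smul, add_mul, mul_add, one_mul, mul_one, map_add,
    hφ.map_one, smul_mul_assoc, mul_smul_comm, map_smul, smul_eq_mul] at h1 h2
  simp [← h3] at h1 h2
  apply Complex.ext
  · simp; linarith
  · simp; linarith

/-- The inner product `⟪a, b⟫ = φ(a⋆ b)` of a faithful state `φ`. -/
@[reducible] def IsState.core {φ : A →ₗ[ℂ] ℂ} (hφ : IsState φ)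
    (hf : ∀ a, φ (star a * a) = 0 → a = 0) : InnerProductSpace.Core ℂ A where
  inner a b := φ (star a * b)
  conj_inner_symm a b := by rw [← hφ.map_star, star_mul, star_star]
  re_inner_nonneg a := (Complex.nonneg_iff.1 (hφ.nonneg a)).1
  add_left a b c := by rw [star_add, add_mul, map_add]
  smul_left a b c := by simp [star_smul]
  definite := hf

/-- The Gelfand–Naimark–Segal space of a faithful state is `A` itself, in orthonormal coordinates. -/
theorem IsState.exists_linearEquiv_euclideanSpace [FiniteDimensional ℂ A] {φ : A →ₗ[ℂ] ℂ}
    (hφ : IsState φ) (hf : ∀ a, φ (star a * a) = 0 → a = 0) :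
    ∃ (n : ℕ) (Φ : A ≃ₗ[ℂ] EuclideanSpace ℂ (Fin n)), ∀ a b, ⟪Φ a, Φ b⟫_ℂ = φ (star a * b) :=
  FiniteQuantumGroup.exists_linearEquiv_euclideanSpace (hφ.core hf)

theorem regularTrace_isState [FiniteDimensional ℂ A] [Nontrivial A] :
    IsState (regularTrace A) :=
  ⟨regularTrace_star_mul_self_nonneg, regularTrace_one⟩

end StateForm

/-! ### Slice maps and convolution -/

section Slices
variable {V B : Type*} [AddCommGroup V] [Module ℂ V] [AddCommGroup B] [Module ℂ B]

/-- The slice map `I ⊗ φ : V ⊗ B → V` of a functional `φ` on `B`. -/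
def slice (V : Type*) [AddCommGroup V] [Module ℂ V] (φ : B →ₗ[ℂ] ℂ) : V ⊗[ℂ] B →ₗ[ℂ] V :=
  (TensorProduct.rid ℂ V).toLinearMap ∘ₗ φ.lTensor V

@[simp] theorem slice_tmul (φ : B →ₗ[ℂ] ℂ) (v : V) (b : B) : slice V φ (v ⊗ₜ b) = φ b • v := by
  simp [slice]

/-- The slice map `φ ⊗ I : V ⊗ B → B` of a functional `φ` on `V`. -/
def lslice (B : Type*) [AddCommGroup B] [Module ℂ B] (φ : V →ₗ[ℂ] ℂ) : V ⊗[ℂ] B →ₗ[ℂ] B :=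
  (TensorProduct.lid ℂ B).toLinearMap ∘ₗ φ.rTensor B

@[simp] theorem lslice_tmul (φ : V →ₗ[ℂ] ℂ) (v : V) (b : B) :
    lslice B φ (v ⊗ₜ b) = φ v • b := by
  simp [lslice]

theorem apply_slice (φ : B →ₗ[ℂ] ℂ) (ψ : V →ₗ[ℂ] ℂ) (t : V ⊗[ℂ] B) :
    ψ (slice V φ t) = φ (lslice B ψ t) := by
  induction t with
  | zero => simp
  | add x y hx hy => simp only [map_add, hx, hy]
  | tmul v b => simp [mul_comm]

theorem eq_sum_slice_tmul {n : Type*} [Fintype n] (b : Module.Basis n ℂ B) (t : V ⊗[ℂ] B) :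
    t = ∑ i, slice V (b.coord i) t ⊗ₜ[ℂ] b i := by
  induction t with
  | zero => simp
  | add x y hx hy =>
    simp only [map_add, TensorProduct.add_tmul, Finset.sum_add_distrib, ← hx, ← hy]
  | tmul v c =>
    simp only [slice_tmul, TensorProduct.smul_tmul, ← TensorProduct.tmul_sum]
    simp [b.sum_repr]

/-- Slicing by all functionals of the second factor recognises the subspace `W ⊗ B`. -/
theorem mem_range_rTensor_subtype [FiniteDimensional ℂ B] {W : Submodule ℂ V} {t : V ⊗[ℂ] B}
    (h : ∀ φ : B →ₗ[ℂ] ℂ, slice V φ t ∈ W) : t ∈ LinearMap.range (W.subtype.rTensor B) := by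
  rw [eq_sum_slice_tmul (Module.finBasis ℂ B) t]
  exact Submodule.sum_mem _ fun i _ => ⟨⟨_, h _⟩ ⊗ₜ Module.finBasis ℂ B i, rfl⟩

theorem slice_mem_of_mem_range_rTensor_subtype {W : Submodule ℂ V} {t : V ⊗[ℂ] B}
    (h : t ∈ LinearMap.range (W.subtype.rTensor B)) (φ : B →ₗ[ℂ] ℂ) : slice V φ t ∈ W := by
  obtain ⟨s, rfl⟩ := h
  induction s with
  | zero => simp
  | add x y hx hy => simpa only [map_add] using W.add_mem hx hy
  | tmul w b => simpa using W.smul_mem _ w.2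

end Slices

variable {A : Type*} [CStarAlgebra A] [FiniteQuantumGroup A]

/-- The convolution `φ ⋆ ψ = (φ ⊗ ψ) ∘ Δ` of two functionals. -/
def conv (φ ψ : A →ₗ[ℂ] ℂ) : A →ₗ[ℂ] ℂ :=
  LinearMap.mul' ℂ ℂ ∘ₗ TensorProduct.map φ ψ ∘ₗ Coalgebra.comul

namespace Corepresentation

section Convolution
variable {V : Type*} [AddCommGroup V] [Module ℂ V]

/-- A corepresentation makes `V` a module over the functionals on `A` with convolution as product. -/
theorem slice_slice (κ : Corepresentation A V) (φ ψ : A →ₗ[ℂ] ℂ) (v : V) :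
    slice V φ (κ.map (slice V ψ (κ.map v))) = slice V (conv φ ψ) (κ.map v) := by
  have h1 : ∀ t : V ⊗[ℂ] A, slice V φ (κ.map (slice V ψ t)) =
      slice V (LinearMap.mul' ℂ ℂ ∘ₗ TensorProduct.map φ ψ)
        (TensorProduct.assoc ℂ V A A (κ.map.rTensor A t)) := by
    intro t
    induction t with
    | zero => simp
    | add x y hx hy => simp only [map_add, hx, hy]
    | tmul w a =>
      simp only [slice_tmul, map_smul, LinearMap.rTensor_tmul]
      induction κ.map w with
      | zero => simp
      | add x y hx hy => simp only [map_add, smul_add, TensorProduct.add_tmul, hx, hy]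
      | tmul u b => simp [smul_smul, mul_comm]
  rw [h1, κ.coassoc]
  simp only [slice, conv, LinearMap.comp_apply, LinearMap.lTensor_comp]

end Convolution

end Corepresentation

/-! ### Convolution idempotency of the regular trace -/

section Regular
variable (A : Type*) [CStarAlgebra A] [FiniteQuantumGroup A]

/-- The regular corepresentation `Δ` on `A`. -/
def regular : Corepresentation A A where
  map := Coalgebra.comul
  coassoc := Coalgebra.coassoc_apply
  counit v := by simp

variable {A}

theorem slice_comul_slice_comul (φ ψ : A →ₗ[ℂ] ℂ) (a : A) :
    slice A φ (Coalgebra.comul (R := ℂ) (slice A ψ (Coalgebra.comul (R := ℂ) a))) =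
      slice A (conv φ ψ) (Coalgebra.comul (R := ℂ) a) :=
  (regular A).slice_slice φ ψ a

theorem lslice_counit_comul (a : A) :
    lslice A (Coalgebra.counit (R := ℂ)) (Coalgebra.comul (R := ℂ) a) = a := by
  simp [lslice]

/-- `φ ⋆ ψ = φ ∘ (I ⊗ ψ) ∘ Δ`. -/
theorem conv_apply_eq_slice (φ ψ : A →ₗ[ℂ] ℂ) (a : A) :
    conv φ ψ a = φ (slice A ψ (Coalgebra.comul (R := ℂ) a)) := by
  simp only [conv, LinearMap.comp_apply]
  induction Coalgebra.comul (R := ℂ) a with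
  | zero => simp
  | add x y hx hy => simp only [map_add, hx, hy]
  | tmul v b => simp [mul_comm]

/-- `φ ⋆ ψ = ψ ∘ (φ ⊗ I) ∘ Δ`. -/
theorem conv_apply_eq_lslice (φ ψ : A →ₗ[ℂ] ℂ) (a : A) :
    conv φ ψ a = ψ (lslice A φ (Coalgebra.comul (R := ℂ) a)) := by
  rw [conv_apply_eq_slice, apply_slice]

variable (A) in
/-- The canonical map `x ⊗ y ↦ Δ(x) (1 ⊗ y)`. -/
def galoisMap : A ⊗[ℂ] A →ₗ[ℂ] A ⊗[ℂ] A :=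
  TensorProduct.lift ((LinearMap.mul ℂ (A ⊗[ℂ] A)).compl₁₂ Coalgebra.comul
    (Algebra.TensorProduct.includeRight : A →ₐ[ℂ] A ⊗[ℂ] A).toLinearMap)

theorem galoisMap_tmul (x y : A) :
    galoisMap A (x ⊗ₜ y) = Coalgebra.comul (R := ℂ) x * ((1 : A) ⊗ₜ[ℂ] y) := by
  simp [galoisMap]

theorem galoisMap_mul_right (t : A ⊗[ℂ] A) (y : A) :
    galoisMap A (t * (1 ⊗ₜ y)) = galoisMap A t * (1 ⊗ₜ y) := by
  induction t with
  | zero => simp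
  | add s t hs ht => simp only [add_mul, map_add, hs, ht]
  | tmul a b => simp [galoisMap_tmul, mul_assoc]

/-- In Sweedler notation, `z₁ ⊗ z₂ S(z₃) = z ⊗ 1`. -/
theorem galoisMap_lTensor_antipode_comul (z : A) :
    galoisMap A ((HopfAlgebra.antipode ℂ (A := A)).lTensor A (Coalgebra.comul (R := ℂ) z)) =
      z ⊗ₜ 1 := by
  have h1 : ∀ t : A ⊗[ℂ] A, galoisMap A ((HopfAlgebra.antipode ℂ (A := A)).lTensor A t) =
      (LinearMap.mul' ℂ A ∘ₗ (HopfAlgebra.antipode ℂ (A := A)).lTensor A).lTensor A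
        (TensorProduct.assoc ℂ A A A ((Coalgebra.comul (R := ℂ) (A := A)).rTensor A t)) := by
    intro t
    induction t with
    | zero => simp
    | add s t hs ht => simp only [map_add, hs, ht]
    | tmul a b =>
      simp only [LinearMap.lTensor_tmul, galoisMap_tmul, LinearMap.rTensor_tmul]
      induction Coalgebra.comul (R := ℂ) a with
      | zero => simp
      | add s t hs ht => simp only [add_mul, TensorProduct.add_tmul, map_add, hs, ht]
      | tmul c d => simp
  rw [h1, Coalgebra.coassoc_apply, ← LinearMap.comp_apply, ← LinearMap.lTensor_comp,
    LinearMap.comp_assoc, HopfAlgebra.mul_antipode_lTensor_comul, LinearMap.lTensor_comp,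
    LinearMap.comp_apply, Coalgebra.lTensor_counit_comul]
  simp

theorem galoisMap_surjective : Function.Surjective (galoisMap A) := by
  intro t
  induction t with
  | zero => exact ⟨0, map_zero _⟩
  | add s t hs ht =>
    obtain ⟨s', rfl⟩ := hs
    obtain ⟨t', rfl⟩ := ht
    exact ⟨s' + t', map_add _ _ _⟩
  | tmul a b =>
    refine ⟨(HopfAlgebra.antipode ℂ (A := A)).lTensor A (Coalgebra.comul (R := ℂ) a) *
      (1 ⊗ₜ b), ?_⟩
    rw [galoisMap_mul_right, galoisMap_lTensor_antipode_comul]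
    simp

/-- The canonical map intertwines the action of `A` on the first factor with the diagonal action of
`A` on `A ⊗ A`. -/
theorem galoisMap_mul_left (a : A) (t : A ⊗[ℂ] A) :
    galoisMap A ((a ⊗ₜ 1) * t) = Coalgebra.comul (R := ℂ) a * galoisMap A t := by
  induction t with
  | zero => simp
  | add s t hs ht => simp only [mul_add, map_add, hs, ht]
  | tmul x y => simp [galoisMap_tmul, mul_assoc]

theorem trace_mulLeft_tensor (t : A ⊗[ℂ] A) :
    LinearMap.trace ℂ (A ⊗[ℂ] A) (LinearMap.mulLeft ℂ t) =
      LinearMap.mul' ℂ ℂ (TensorProduct.map (LinearMap.trace ℂ A ∘ₗ LinearMap.mul ℂ A)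
        (LinearMap.trace ℂ A ∘ₗ LinearMap.mul ℂ A) t) := by
  change LinearMap.trace ℂ (A ⊗[ℂ] A) (LinearMap.mul ℂ _ t) = _
  induction t with
  | zero => simp
  | add s t hs ht => simp only [map_add, hs, ht]
  | tmul x y =>
    have : LinearMap.mul ℂ (A ⊗[ℂ] A) (x ⊗ₜ y) =
        TensorProduct.map (LinearMap.mul ℂ A x) (LinearMap.mul ℂ A y) := by
      ext; simp
    rw [this, LinearMap.trace_tensorProduct']
    simp

/-- The regular trace is an idempotent for convolution. The trace of `Δ(a)` acting on `A ⊗ A` is on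
the one hand `(Tr ⊗ Tr)(Δ(a))`, on the other hand, by conjugating with the canonical map, that of
`L_a ⊗ I`, which is `dim A` times the trace of `L_a`. -/
theorem conv_regularTrace_self [Nontrivial A] :
    conv (regularTrace A) (regularTrace A) = regularTrace A := by
  ext a
  let e : (A ⊗[ℂ] A) ≃ₗ[ℂ] A ⊗[ℂ] A := LinearEquiv.ofBijective (galoisMap A)
    ⟨LinearMap.injective_iff_surjective.2 galoisMap_surjective, galoisMap_surjective⟩
  have he : e.conj (LinearMap.mulLeft ℂ (a ⊗ₜ[ℂ] (1 : A))) =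
      LinearMap.mulLeft ℂ (Coalgebra.comul (R := ℂ) a) := by
    apply LinearMap.ext
    intro t
    obtain ⟨s, rfl⟩ := e.surjective t
    rw [LinearEquiv.conj_apply_apply, e.symm_apply_apply]
    exact galoisMap_mul_left a s
  have h := LinearMap.trace_conj' (LinearMap.mulLeft ℂ (a ⊗ₜ[ℂ] (1 : A))) e
  rw [he, trace_mulLeft_tensor, trace_mulLeft_tensor] at h
  have h1 : (LinearMap.trace ℂ A) (LinearMap.mul ℂ A 1) = Module.finrank ℂ A := by
    rw [← LinearMap.trace_one]; congr 1; ext; simp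
  have hd : (Module.finrank ℂ A : ℂ) ≠ 0 := by exact_mod_cast Module.finrank_pos.ne'
  simp only [TensorProduct.map_tmul, LinearMap.mul'_apply, LinearMap.comp_apply, h1] at h
  simp only [regularTrace, conv, LinearMap.comp_apply, TensorProduct.map_smul_left,
    TensorProduct.map_smul_right, LinearMap.smul_apply, map_smul, h, smul_eq_mul]
  field_simp

end Regular

/-! ### The Haar state is the regular trace -/

section Haar
variable {A : Type*} [CStarAlgebra A]

theorem slice_tmul_one_mul (φ : A →ₗ[ℂ] ℂ) (x : A) (t : A ⊗[ℂ] A) :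
    slice A φ ((x ⊗ₜ 1) * t) = x * slice A φ t := by
  induction t with
  | zero => simp
  | add s t hs ht => simp only [mul_add, map_add, hs, ht]
  | tmul a b => simp

theorem slice_mul_tmul_one (φ : A →ₗ[ℂ] ℂ) (x : A) (t : A ⊗[ℂ] A) :
    slice A φ (t * (x ⊗ₜ 1)) = slice A φ t * x := by
  induction t with
  | zero => simp
  | add s t hs ht => simp only [add_mul, map_add, hs, ht]
  | tmul a b => simp

theorem slice_star {φ : A →ₗ[ℂ] ℂ} (hφ : IsState φ) (t : A ⊗[ℂ] A) :
    slice A φ (star t) = star (slice A φ t) := by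
  induction t with
  | zero => simp
  | add s t hs ht => simp only [star_add, map_add, hs, ht]
  | tmul a b => simp [hφ.map_star]

theorem IsState.nontrivial {φ : A →ₗ[ℂ] ℂ} (hφ : IsState φ) : Nontrivial A := by
  refine ⟨⟨0, 1, fun h => ?_⟩⟩
  have := hφ.map_one
  rw [← h, map_zero] at this
  exact zero_ne_one this

variable [FiniteQuantumGroup A]

/-- If `φ` is a faithful state, so is `φ ⊗ φ`. -/
theorem eq_zero_of_apply_slice_star_mul_self {φ : A →ₗ[ℂ] ℂ} (hφ : IsState φ)
    (hf : ∀ a, φ (star a * a) = 0 → a = 0) {t : A ⊗[ℂ] A}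
    (h : φ (slice A φ (star t * t)) = 0) : t = 0 := by
  obtain ⟨n, Φ, hΦ⟩ := hφ.exists_linearEquiv_euclideanSpace hf
  let b : Module.Basis (Fin n) ℂ A := Module.Basis.ofEquivFun (Φ ≪≫ₗ WithLp.linearEquiv 2 ℂ _)
  have hb : ∀ i j, φ (star (b i) * b j) = if i = j then 1 else 0 := by
    intro i j
    have hbi : ∀ i, Φ (b i) = EuclideanSpace.single i 1 := by
      intro i
      simp [b]
    rw [← hΦ, hbi, hbi]
    rw [EuclideanSpace.inner_single_left]
    simp
  set y : Fin n → A := fun i => slice A (b.coord i) t with hy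
  have ht : t = ∑ i, y i ⊗ₜ[ℂ] b i := eq_sum_slice_tmul b t
  have h1 : slice A φ (star t * t) = ∑ i, star (y i) * y i := by
    rw [ht, star_sum, Finset.sum_mul_sum, map_sum]
    refine Finset.sum_congr rfl fun i _ => ?_
    simp [hb]
  rw [h1, map_sum, Finset.sum_eq_zero_iff_of_nonneg fun i _ => hφ.nonneg _] at h
  rw [ht]
  exact Finset.sum_eq_zero fun i hi => by rw [hf _ (h i hi), TensorProduct.zero_tmul]

/-- A faithful idempotent state is left invariant. The map `E = (I ⊗ φ) ∘ Δ` is idempotent, and for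
`x = E(a)` the element `y = Δ(x) - x ⊗ 1` satisfies `(I ⊗ φ)(y⋆ y) = E(x⋆ x) - x⋆ x`, which `φ` kills
since `φ ∘ E = φ`. Hence `Δ(x) = x ⊗ 1`, which forces `x` to be a scalar. -/
theorem slice_comul_eq_of_conv_self {φ : A →ₗ[ℂ] ℂ} (hφ : IsState φ)
    (hf : ∀ a, φ (star a * a) = 0 → a = 0) (hc : conv φ φ = φ) (a : A) :
    slice A φ (Coalgebra.comul (R := ℂ) a) = φ a • (1 : A) := by
  set x := slice A φ (Coalgebra.comul (R := ℂ) a) with hx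
  have hEx : slice A φ (Coalgebra.comul (R := ℂ) x) = x := by
    rw [hx, slice_comul_slice_comul, hc]
  have hy : Coalgebra.comul (R := ℂ) x - x ⊗ₜ[ℂ] (1 : A) = 0 := by
    apply eq_zero_of_apply_slice_star_mul_self hφ hf
    have h1 : star (x ⊗ₜ[ℂ] (1 : A)) = star x ⊗ₜ[ℂ] (1 : A) := by simp
    rw [star_sub, sub_mul, mul_sub, mul_sub, h1, ← FiniteQuantumGroup.comul_star,
      ← FiniteQuantumGroup.comul_mul]
    simp only [map_sub, slice_mul_tmul_one, slice_tmul_one_mul, slice_tmul, hφ.map_one, one_smul,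
      hEx]
    rw [FiniteQuantumGroup.comul_star, slice_star hφ, hEx, ← conv_apply_eq_slice, hc]
    simp
  rw [sub_eq_zero] at hy
  have hx1 : x = Coalgebra.counit (R := ℂ) x • (1 : A) := by
    conv_lhs => rw [← lslice_counit_comul x, hy, lslice_tmul]
  have h2 : φ x = φ a := by rw [hx, ← conv_apply_eq_slice, hc]
  rw [hx1, map_smul, hφ.map_one, smul_eq_mul, mul_one] at h2
  rw [hx1, h2]

theorem IsHaarState.lslice_comul {π : A →ₗ[ℂ] ℂ} (hπ : IsHaarState π) (a : A) :
    lslice A π (Coalgebra.comul (R := ℂ) a) = π a • (1 : A) :=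
  hπ.right_invariant a

theorem IsHaarState.slice_comul {π : A →ₗ[ℂ] ℂ} (hπ : IsHaarState π) (a : A) :
    slice A π (Coalgebra.comul (R := ℂ) a) = π a • (1 : A) :=
  hπ.left_invariant a

/-- The Haar state is the regular trace: `π ⋆ τ` equals `π ∘ E = τ` for `E = (I ⊗ τ) ∘ Δ = τ(·) 1`,
and equals `π` by right invariance of `π`. So the Haar state is tracial and faithful. -/
theorem IsHaarState.eq_regularTrace {π : A →ₗ[ℂ] ℂ} (hπ : IsHaarState π) :
    π = regularTrace A := by
  have := hπ.isState.nontrivial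
  have hτ : IsState (regularTrace A) := regularTrace_isState
  ext a
  have h1 : conv π (regularTrace A) a = regularTrace A a := by
    rw [conv_apply_eq_slice, slice_comul_eq_of_conv_self hτ (fun a => regularTrace_faithful)
      conv_regularTrace_self, map_smul, hπ.isState.map_one, smul_eq_mul, mul_one]
  rw [← h1, conv_apply_eq_lslice, hπ.lslice_comul, map_smul, hτ.map_one, smul_eq_mul, mul_one]

theorem IsHaarState.mul_comm {π : A →ₗ[ℂ] ℂ} (hπ : IsHaarState π) (a b : A) :
    π (a * b) = π (b * a) := by
  rw [hπ.eq_regularTrace, regularTrace_mul_comm]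

theorem IsHaarState.faithful {π : A →ₗ[ℂ] ℂ} (hπ : IsHaarState π) (a : A)
    (h : π (star a * a) = 0) : a = 0 := by
  rw [hπ.eq_regularTrace] at h
  exact regularTrace_faithful h

theorem IsHaarState.bijective_vanDaele {π : A →ₗ[ℂ] ℂ} (hπ : IsHaarState π) :
    Function.Bijective (vanDaele π) := by
  let F : A →ₗ[ℂ] (A →ₗ[ℂ] ℂ) := (LinearMap.mul ℂ A).flip.compr₂ π
  have hinj : Function.Injective F := by
    rw [injective_iff_map_eq_zero]
    intro a ha
    exact hπ.faithful a (LinearMap.congr_fun ha (star a))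
  exact ⟨hinj, (LinearMap.injective_iff_surjective_of_finrank_eq_finrank
    (Subspace.dual_finrank_eq (K := ℂ) (V := A)).symm).1 hinj⟩

end Haar

/-! ### Schur's lemma and the orthogonality relations -/

namespace Corepresentation

variable {A : Type*} [CStarAlgebra A] [FiniteQuantumGroup A]

section Intertwiners
variable {V W : Type*} [AddCommGroup V] [Module ℂ V] [AddCommGroup W] [Module ℂ W]

theorem slice_rTensor {B : Type*} [AddCommGroup B] [Module ℂ B] (φ : B →ₗ[ℂ] ℂ) (T : V →ₗ[ℂ] W)
    (t : V ⊗[ℂ] B) : slice W φ (T.rTensor B t) = T (slice V φ t) := by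
  induction t with
  | zero => simp
  | add x y hx hy => simp only [map_add, hx, hy]
  | tmul v b => simp

theorem lslice_rTensor {B : Type*} [AddCommGroup B] [Module ℂ B] (φ : W →ₗ[ℂ] ℂ) (T : V →ₗ[ℂ] W)
    (t : V ⊗[ℂ] B) : lslice B φ (T.rTensor B t) = lslice B (φ ∘ₗ T) t := by
  induction t with
  | zero => simp
  | add x y hx hy => simp only [map_add, hx, hy]
  | tmul v b => simp

/-- `T` is an intertwiner from `κ` to `κ₀`, i.e. `κ₀ T = (T ⊗ I) κ`. -/
def IsIntertwiner (κ : Corepresentation A V) (κ₀ : Corepresentation A W) (T : V →ₗ[ℂ] W) : Prop :=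
  ∀ v, κ₀.map (T v) = T.rTensor A (κ.map v)

theorem IsIrreducible.eq_bot_or_eq_top {κ : Corepresentation A V} (hκ : κ.IsIrreducible)
    {W : Submodule ℂ V} (h : ∀ w ∈ W, ∀ φ : A →ₗ[ℂ] ℂ, slice V φ (κ.map w) ∈ W) :
    W = ⊥ ∨ W = ⊤ :=
  hκ.2 W fun w hw => mem_range_rTensor_subtype (h w hw)

/-- Schur's lemma: the kernel and the range of an intertwiner are invariant. -/
theorem IsIntertwiner.eq_zero_or_bijective {κ : Corepresentation A V} {κ₀ : Corepresentation A W}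
    {T : V →ₗ[ℂ] W} (hT : IsIntertwiner κ κ₀ T) (hκ : κ.IsIrreducible) (hκ₀ : κ₀.IsIrreducible) :
    T = 0 ∨ Function.Bijective T := by
  have hker : T.ker = ⊥ ∨ T.ker = ⊤ := by
    refine hκ.eq_bot_or_eq_top fun w hw φ => ?_
    rw [LinearMap.mem_ker] at hw ⊢
    rw [← slice_rTensor, ← hT, hw, map_zero, map_zero]
  have hran : T.range = ⊥ ∨ T.range = ⊤ := by
    refine hκ₀.eq_bot_or_eq_top ?_
    rintro _ ⟨v, rfl⟩ φ
    rw [hT, slice_rTensor]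
    exact LinearMap.mem_range_self _ _
  rcases hker with h | h
  · rcases hran with h' | h'
    · exact Or.inl (LinearMap.range_eq_bot.1 h')
    · exact Or.inr ⟨LinearMap.ker_eq_bot.1 h, LinearMap.range_eq_top.1 h'⟩
  · exact Or.inl (LinearMap.ker_eq_top.1 h)

theorem IsIntertwiner.eq_zero_of_not_equivalent {κ : Corepresentation A V}
    {κ₀ : Corepresentation A W} {T : V →ₗ[ℂ] W} (hT : IsIntertwiner κ κ₀ T)
    (hκ : κ.IsIrreducible) (hκ₀ : κ₀.IsIrreducible) (h : ¬ κ.Equivalent κ₀) : T = 0 :=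
  (hT.eq_zero_or_bijective hκ hκ₀).resolve_right fun hb =>
    h ⟨LinearEquiv.ofBijective T hb, hT⟩

theorem IsIntertwiner.exists_eq_smul_id [FiniteDimensional ℂ V] {κ : Corepresentation A V}
    {T : V →ₗ[ℂ] V} (hT : IsIntertwiner κ κ T) (hκ : κ.IsIrreducible) :
    ∃ c : ℂ, T = c • LinearMap.id := by
  have := hκ.1
  obtain ⟨c, hc⟩ := Module.End.exists_eigenvalue T
  obtain ⟨v, hv⟩ := hc.exists_hasEigenvector
  refine ⟨c, sub_eq_zero.1 ?_⟩
  have hT' : IsIntertwiner κ κ (T - c • LinearMap.id) := fun w => by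
    simp [hT w, LinearMap.rTensor_sub, LinearMap.rTensor_smul]
  refine (hT'.eq_zero_or_bijective hκ hκ).resolve_right fun hb => hv.2 (hb.1 ?_)
  simp [hv.apply_eq_smul]

theorem Equivalent.symm {κ : Corepresentation A V} {κ₀ : Corepresentation A W}
    (h : κ.Equivalent κ₀) : κ₀.Equivalent κ := by
  obtain ⟨T, hT⟩ := h
  refine ⟨T.symm, fun w => ?_⟩
  have := hT (T.symm w)
  rw [T.apply_symm_apply] at this
  rw [this, ← LinearMap.comp_apply, ← LinearMap.rTensor_comp]
  simp

end Intertwiners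

section Coeff
variable {V W : Type*} [NormedAddCommGroup V] [InnerProductSpace ℂ V]
  [NormedAddCommGroup W] [InnerProductSpace ℂ W] {n m : Type*} [Fintype n] [Fintype m]

/-- Expansion of a tensor along an orthonormal basis of its first factor. -/
theorem eq_sum_tmul_lslice {B : Type*} [AddCommGroup B] [Module ℂ B]
    (e : OrthonormalBasis n ℂ V) (t : V ⊗[ℂ] B) :
    t = ∑ i, e i ⊗ₜ[ℂ] lslice B (innerₛₗ ℂ (e i)) t := by
  induction t with
  | zero => simp
  | add x y hx hy =>
    simp only [map_add, TensorProduct.tmul_add, Finset.sum_add_distrib, ← hx, ← hy]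
  | tmul v c =>
    simp only [lslice_tmul, ← TensorProduct.smul_tmul, ← TensorProduct.sum_tmul, innerₛₗ_apply_apply,
      e.sum_repr']

/-- The matrix `(ρᵢⱼ)` of coefficients of `κ` in an orthonormal basis `e`, determined by
`κ(eⱼ) = ∑ᵢ eᵢ ⊗ ρᵢⱼ`. -/
def coeff (κ : Corepresentation A V) (e : OrthonormalBasis n ℂ V) : Matrix n n A :=
  fun i j => lslice A (innerₛₗ ℂ (e i)) (κ.map (e j))

theorem map_eq_sum_coeff (κ : Corepresentation A V) (e : OrthonormalBasis n ℂ V) (j : n) :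
    κ.map (e j) = ∑ i, e i ⊗ₜ[ℂ] κ.coeff e i j :=
  eq_sum_tmul_lslice e _

theorem comul_coeff (κ : Corepresentation A V) (e : OrthonormalBasis n ℂ V) (i j : n) :
    Coalgebra.comul (R := ℂ) (κ.coeff e i j) = ∑ k, κ.coeff e i k ⊗ₜ[ℂ] κ.coeff e k j := by
  have h1 : ∀ (ψ : V →ₗ[ℂ] ℂ) (t : V ⊗[ℂ] A), lslice (A ⊗[ℂ] A) ψ
      ((Coalgebra.comul (R := ℂ) (A := A)).lTensor V t) =
        Coalgebra.comul (R := ℂ) (lslice A ψ t) := by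
    intro ψ t
    induction t with
    | zero => simp
    | add x y hx hy => simp only [map_add, hx, hy]
    | tmul v c => simp
  have h2 : ∀ (ψ : V →ₗ[ℂ] ℂ) (t : V ⊗[ℂ] A) (a : A), lslice (A ⊗[ℂ] A) ψ
      (TensorProduct.assoc ℂ V A A (t ⊗ₜ a)) = lslice A ψ t ⊗ₜ a := by
    intro ψ t a
    induction t with
    | zero => simp
    | add x y hx hy => simp only [map_add, TensorProduct.add_tmul, hx, hy]
    | tmul v c => simp [TensorProduct.smul_tmul']
  have h3 := congrArg (lslice (A ⊗[ℂ] A) (innerₛₗ ℂ (e i))) (κ.coassoc (e j))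
  rw [h1] at h3
  change _ = Coalgebra.comul (R := ℂ) (κ.coeff e i j) at h3
  rw [← h3, map_eq_sum_coeff κ e j]
  simp only [map_sum, LinearMap.rTensor_tmul, h2]
  rfl

variable [DecidableEq n] [DecidableEq m]

theorem counit_coeff (κ : Corepresentation A V) (e : OrthonormalBasis n ℂ V) (i j : n) :
    Coalgebra.counit (R := ℂ) (κ.coeff e i j) = if i = j then 1 else 0 := by
  rw [coeff, ← apply_slice]
  have : slice V (Coalgebra.counit (R := ℂ)) (κ.map (e j)) = e j := κ.counit (e j)
  rw [this, innerₛₗ_apply_apply, orthonormal_iff_ite.1 e.orthonormal]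

theorem IsUnitary.conjTranspose_coeff_mul {κ : Corepresentation A V} (hκ : κ.IsUnitary)
    (e : OrthonormalBasis n ℂ V) : (κ.coeff e).conjTranspose * κ.coeff e = 1 := by
  ext i j
  have h := hκ (e i) (e j)
  rw [map_eq_sum_coeff κ e i, map_eq_sum_coeff κ e j, orthonormal_iff_ite.1 e.orthonormal] at h
  simp only [map_sum, LinearMap.sum_apply, innerA_tmul, orthonormal_iff_ite.1 e.orthonormal,
    ite_smul, one_smul, zero_smul, Finset.sum_ite_eq', Finset.mem_univ,
    if_true] at h
  rw [Matrix.mul_apply, Matrix.one_apply]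
  simpa [Matrix.conjTranspose_apply] using h

/-- A left inverse of a square matrix over the finite-dimensional algebra `A` is a right inverse. -/
theorem IsUnitary.coeff_mul_conjTranspose {κ : Corepresentation A V} (hκ : κ.IsUnitary)
    (e : OrthonormalBasis n ℂ V) : κ.coeff e * (κ.coeff e).conjTranspose = 1 := by
  have := IsNoetherianRing.of_finite ℂ A
  exact mul_eq_one_symm (hκ.conjTranspose_coeff_mul e)

end Coeff

section Orthogonality
variable {V W : Type*} [NormedAddCommGroup V] [InnerProductSpace ℂ V]
  [NormedAddCommGroup W] [InnerProductSpace ℂ W] {n m : Type*} [Fintype n] [Fintype m]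
  [DecidableEq n] {π : A →ₗ[ℂ] ℂ}

theorem isIntertwiner_of_matrix {κ : Corepresentation A V} {κ₀ : Corepresentation A W}
    (e : OrthonormalBasis n ℂ V) (f : OrthonormalBasis m ℂ W) {T : Matrix m n ℂ}
    (hT : T.map (algebraMap ℂ A) * κ.coeff e = κ₀.coeff f * T.map (algebraMap ℂ A)) :
    IsIntertwiner κ κ₀ (T.toLin e.toBasis f.toBasis) := by
  have hTe : ∀ j, T.toLin e.toBasis f.toBasis (e j) = ∑ i, T i j • f i := fun j => by
    simpa using Matrix.toLin_self e.toBasis f.toBasis T j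
  suffices h : κ₀.map ∘ₗ T.toLin e.toBasis f.toBasis =
      (T.toLin e.toBasis f.toBasis).rTensor A ∘ₗ κ.map from LinearMap.congr_fun h
  refine e.toBasis.ext fun j => ?_
  simp only [OrthonormalBasis.coe_toBasis, LinearMap.comp_apply, hTe, map_sum, map_smul,
    map_eq_sum_coeff, LinearMap.rTensor_tmul, TensorProduct.sum_tmul, Finset.smul_sum]
  rw [Finset.sum_comm, Finset.sum_comm (s := (Finset.univ : Finset n))]
  refine Finset.sum_congr rfl fun p _ => ?_
  have h := congrFun (congrFun hT p) j
  simp only [Matrix.mul_apply, Matrix.map_apply, ← Algebra.commutes (R := ℂ) (A := A),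
    ← Algebra.smul_def] at h
  simp only [TensorProduct.smul_tmul, ← TensorProduct.tmul_smul, ← TensorProduct.tmul_sum, h]

/-- For coefficient matrices `u` and `v`, right invariance of the Haar state says that the scalar
matrix `Tᵢⱼ = π(uₖᵢ⋆ vₗⱼ)` satisfies `u⋆ T v = T`; as `u` is unitary, `T v = u T`. -/
theorem isIntertwiner_of_right_invariant [DecidableEq m] (hπ : IsHaarState π)
    {κ : Corepresentation A V} {κ₀ : Corepresentation A W} (hκ₀ : κ₀.IsUnitary)
    (e : OrthonormalBasis n ℂ V) (f : OrthonormalBasis m ℂ W) (k : m) (l : n) :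
    IsIntertwiner κ κ₀ (Matrix.toLin e.toBasis f.toBasis
      (Matrix.of fun i j => π (star (κ₀.coeff f k i) * κ.coeff e l j))) := by
  apply isIntertwiner_of_matrix
  set u := κ₀.coeff f with hu
  set v := κ.coeff e with hv
  set T : Matrix m n ℂ := Matrix.of fun i j => π (star (u k i) * v l j) with hT
  have h1 : u.conjTranspose * T.map (algebraMap ℂ A) * v = T.map (algebraMap ℂ A) := by
    ext i j
    have h := hπ.lslice_comul (star (u k i) * v l j)
    rw [FiniteQuantumGroup.comul_mul, FiniteQuantumGroup.comul_star, κ₀.comul_coeff,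
      κ.comul_coeff, star_sum, Finset.sum_mul_sum] at h
    rw [Matrix.map_apply, Algebra.algebraMap_eq_smul_one, hT, Matrix.of_apply, ← h]
    simp only [Matrix.mul_apply, Finset.sum_mul, map_sum]
    rw [Finset.sum_comm]
    refine Finset.sum_congr rfl fun p _ => Finset.sum_congr rfl fun q _ => ?_
    rw [TensorProduct.star_tmul, Algebra.TensorProduct.tmul_mul_tmul, lslice_tmul,
      Matrix.map_apply, Matrix.conjTranspose_apply, ← Algebra.commutes, mul_assoc,
      ← Algebra.smul_def, Matrix.of_apply]
  calc T.map (algebraMap ℂ A) * v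
      = u * u.conjTranspose * T.map (algebraMap ℂ A) * v := by
        rw [hκ₀.coeff_mul_conjTranspose, Matrix.one_mul]
    _ = u * T.map (algebraMap ℂ A) := by
        rw [Matrix.mul_assoc, Matrix.mul_assoc, ← Matrix.mul_assoc _ _ v, h1]

/-- For coefficient matrices `u` and `v`, left invariance of the Haar state says that the scalar
matrix `Tᵢⱼ = π(uᵢₖ vⱼₗ⋆)` satisfies `u T v⋆ = T`; as `v` is unitary, `T v = u T`. -/
theorem isIntertwiner_of_left_invariant (hπ : IsHaarState π)
    {κ : Corepresentation A V} {κ₀ : Corepresentation A W} (hκ : κ.IsUnitary)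
    (e : OrthonormalBasis n ℂ V) (f : OrthonormalBasis m ℂ W) (k : m) (l : n) :
    IsIntertwiner κ κ₀ (Matrix.toLin e.toBasis f.toBasis
      (Matrix.of fun i j => π (κ₀.coeff f i k * star (κ.coeff e j l)))) := by
  apply isIntertwiner_of_matrix
  set u := κ₀.coeff f with hu
  set v := κ.coeff e with hv
  set T : Matrix m n ℂ := Matrix.of fun i j => π (u i k * star (v j l)) with hT
  have h1 : u * T.map (algebraMap ℂ A) * v.conjTranspose = T.map (algebraMap ℂ A) := by
    ext i j
    have h := hπ.slice_comul (u i k * star (v j l))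
    rw [FiniteQuantumGroup.comul_mul, FiniteQuantumGroup.comul_star, κ₀.comul_coeff,
      κ.comul_coeff, star_sum, Finset.sum_mul_sum] at h
    rw [Matrix.map_apply, Algebra.algebraMap_eq_smul_one, hT, Matrix.of_apply, ← h]
    simp only [Matrix.mul_apply, Finset.sum_mul, map_sum]
    rw [Finset.sum_comm]
    refine Finset.sum_congr rfl fun p _ => Finset.sum_congr rfl fun q _ => ?_
    rw [TensorProduct.star_tmul, Algebra.TensorProduct.tmul_mul_tmul, slice_tmul,
      Matrix.map_apply, Matrix.conjTranspose_apply, ← Algebra.commutes, mul_assoc,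
      ← Algebra.smul_def, Matrix.of_apply]
  rw [← h1, Matrix.mul_assoc, hκ.conjTranspose_coeff_mul, Matrix.mul_one, h1]

theorem eq_zero_of_toLin_eq_zero {e : OrthonormalBasis n ℂ V} {f : OrthonormalBasis m ℂ W}
    {T : Matrix m n ℂ} (h : T.toLin e.toBasis f.toBasis = 0) (i : m) (j : n) : T i j = 0 := by
  have : T = 0 := (Matrix.toLin e.toBasis f.toBasis).map_eq_zero_iff.1 h
  rw [this, Matrix.zero_apply]

/-- Coefficients of inequivalent irreducible unitary corepresentations are orthogonal. -/
theorem haar_star_coeff_mul_coeff_of_not_equivalent (hπ : IsHaarState π)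
    {κ : Corepresentation A V} {κ₀ : Corepresentation A W} (hκ : κ.IsIrreducible)
    (hκ₀ : κ₀.IsIrreducible) (hu : κ₀.IsUnitary) (h : ¬ κ.Equivalent κ₀)
    (e : OrthonormalBasis n ℂ V) (f : OrthonormalBasis m ℂ W) (k i : m) (l j : n) :
    π (star (κ₀.coeff f k i) * κ.coeff e l j) = 0 := by
  classical
  exact eq_zero_of_toLin_eq_zero ((isIntertwiner_of_right_invariant hπ hu e f k l
    ).eq_zero_of_not_equivalent hκ hκ₀ h) i j

/-- A self-intertwiner of an irreducible corepresentation has a scalar matrix. -/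
theorem IsIntertwiner.exists_eq_ite {κ : Corepresentation A V} (hκ : κ.IsIrreducible)
    {e : OrthonormalBasis n ℂ V} {T : Matrix n n ℂ}
    (hT : IsIntertwiner κ κ (T.toLin e.toBasis e.toBasis)) :
    ∃ c : ℂ, ∀ i j, T i j = if i = j then c else 0 := by
  have := e.toBasis.finiteDimensional_of_finite
  obtain ⟨c, hc⟩ := hT.exists_eq_smul_id hκ
  refine ⟨c, fun i j => ?_⟩
  have h : T = c • 1 := by
    apply (Matrix.toLin e.toBasis e.toBasis).injective
    rw [hc, map_smul, Matrix.toLin_one]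
  rw [h, Matrix.smul_apply, Matrix.one_apply]
  simp

/-- Coefficients of one irreducible unitary corepresentation: Schur's lemma gives
`π(ρₖᵢ⋆ ρₗⱼ) = cₖₗ δᵢⱼ` and `π(ρᵢₖ ρⱼₗ⋆) = dₖₗ δᵢⱼ`. As `π` is tracial, the two expressions agree, so
`c` is a scalar matrix, and unitarity gives it trace `1`. -/
theorem haar_star_coeff_mul_coeff (hπ : IsHaarState π) {κ : Corepresentation A V}
    (hκ : κ.IsIrreducible) (hu : κ.IsUnitary) (e : OrthonormalBasis n ℂ V) (k i l j : n) :
    π (star (κ.coeff e k i) * κ.coeff e l j) =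
      if k = l ∧ i = j then (Fintype.card n : ℂ)⁻¹ else 0 := by
  have := hκ.1
  have hne : Nonempty n := e.toBasis.index_nonempty
  choose c hc using fun k l => IsIntertwiner.exists_eq_ite hκ
    (isIntertwiner_of_right_invariant (κ := κ) (κ₀ := κ) hπ hu e e k l)
  choose d hd using fun k l => IsIntertwiner.exists_eq_ite hκ
    (isIntertwiner_of_left_invariant (κ := κ) (κ₀ := κ) hπ hu e e k l)
  simp only [Matrix.of_apply] at hc hd
  have hcd : ∀ k l i j, (if i = j then c k l else 0) = if l = k then d j i else 0 := by
    intro k l i j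
    rw [← hc, hπ.mul_comm, hd]
  obtain ⟨o⟩ := hne
  have h1 : ∀ k l, c k l = if k = l then d o o else 0 := by
    intro k l
    simpa [eq_comm] using hcd k l o o
  have h2 : (Fintype.card n : ℂ) * d o o = 1 := by
    have h := congrFun (congrFun (hu.conjTranspose_coeff_mul e) o) o
    rw [Matrix.mul_apply, Matrix.one_apply_eq] at h
    have h' := congrArg π h
    rw [map_sum, hπ.isState.map_one] at h'
    simpa [Matrix.conjTranspose_apply, hc, h1] using h'
  rw [hc, h1, eq_inv_of_mul_eq_one_right h2]
  by_cases hkl : k = l <;> by_cases hij : i = j <;> simp [hkl, hij]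

end Orthogonality

end Corepresentation

/-! ### The Peter–Weyl theorem -/

/-- A subspace of `A`, with the inner product `π(a⋆ b)`, is isometric to a Euclidean space. -/
theorem IsHaarState.exists_isometry_range_eq {A : Type*} [CStarAlgebra A] [FiniteQuantumGroup A]
    {π : A →ₗ[ℂ] ℂ} (hπ : IsHaarState π) (W : Submodule ℂ A) :
    ∃ (m : ℕ) (T : EuclideanSpace ℂ (Fin m) →ₗ[ℂ] A), LinearMap.range T = W ∧
      ∀ v u, π (star (T v) * T u) = ⟪v, u⟫_ℂ := by
  obtain ⟨n, Φ, hΦ⟩ := hπ.isState.exists_linearEquiv_euclideanSpace hπ.faithful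
  let W' : Submodule ℂ (EuclideanSpace ℂ (Fin n)) := W.map Φ.toLinearMap
  let b := stdOrthonormalBasis ℂ W'
  refine ⟨_, Φ.symm.toLinearMap ∘ₗ W'.subtype ∘ₗ b.repr.symm.toLinearEquiv.toLinearMap, ?_, ?_⟩
  · rw [LinearMap.range_comp, LinearEquiv.range_comp, Submodule.range_subtype]
    ext a
    simp [W']
  · intro v u
    rw [← hΦ]
    rw [← b.repr.symm.inner_map_map v u, Submodule.coe_inner]
    simp

section
variable {A : Type*} [CStarAlgebra A]

/-- Through an isometry `T` into `A` with its inner product `π(a⋆ b)`, the `A`-valued inner product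
becomes `(π ⊗ I)(s⋆ t)` on `A ⊗ A`. -/
theorem innerA_eq_lslice {E : Type*} [NormedAddCommGroup E] [InnerProductSpace ℂ E]
    {π : A →ₗ[ℂ] ℂ} {T : E →ₗ[ℂ] A} (hT : ∀ v u, π (star (T v) * T u) = ⟪v, u⟫_ℂ)
    (s t : E ⊗[ℂ] A) :
    innerA A E s t = lslice A π (star (T.rTensor A s) * T.rTensor A t) := by
  induction s with
  | zero => simp
  | add x y hx hy => simp only [map_add, LinearMap.add_apply, star_add, add_mul, hx, hy]
  | tmul v a =>
    induction t with
    | zero => simp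
    | add x y hx hy => simp only [map_add, mul_add, hx, hy]
    | tmul u b => simp [innerA_tmul, hT]

end

namespace Corepresentation

variable {A : Type*} [CStarAlgebra A] [FiniteQuantumGroup A]

section Restrict
variable {V W : Type*} [AddCommGroup V] [Module ℂ V] [AddCommGroup W] [Module ℂ W]

/-- The restriction of `κ` to an invariant subspace, given as the image of `T : W → V` with left
inverse `P`; invariance is the hypothesis that `T P` fixes `κ(T w)` in the first factor. -/
def restrict (κ : Corepresentation A V) (T : W →ₗ[ℂ] V) (P : V →ₗ[ℂ] W)
    (hPT : P ∘ₗ T = LinearMap.id)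
    (h : ∀ w, T.rTensor A (P.rTensor A (κ.map (T w))) = κ.map (T w)) : Corepresentation A W where
  map := P.rTensor A ∘ₗ κ.map ∘ₗ T
  coassoc w := by
    have h1 : ∀ t : (V ⊗[ℂ] A) ⊗[ℂ] A, TensorProduct.assoc ℂ W A A
        ((P.rTensor A).rTensor A t) =
          P.rTensor (A ⊗[ℂ] A) (TensorProduct.assoc ℂ V A A t) := by
      intro t
      induction t with
      | zero => simp
      | add s t hs ht => simp only [map_add, hs, ht]
      | tmul s a =>
        induction s with
        | zero => simp
        | add s t hs ht => simp only [map_add, TensorProduct.add_tmul, hs, ht]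
        | tmul v b => simp
    have h2 : ∀ t : V ⊗[ℂ] A, P.rTensor (A ⊗[ℂ] A) ((Coalgebra.comul (R := ℂ)).lTensor V t) =
        (Coalgebra.comul (R := ℂ)).lTensor W (P.rTensor A t) := by
      intro t
      rw [← LinearMap.comp_apply, ← LinearMap.comp_apply, LinearMap.rTensor_comp_lTensor,
        LinearMap.lTensor_comp_rTensor]
    simp only [LinearMap.rTensor_comp, LinearMap.comp_apply, h, h1, κ.coassoc, h2]
  counit w := by
    change slice W _ _ = w
    simp only [LinearMap.comp_apply, slice_rTensor]
    have : slice V (Coalgebra.counit (R := ℂ)) (κ.map (T w)) = T w := κ.counit (T w)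
    rw [this]
    exact LinearMap.congr_fun hPT w

end Restrict

section PeterWeyl

variable {π : A →ₗ[ℂ] ℂ}

/-- A nonzero invariant subspace `C` of the regular corepresentation contains the image of an
irreducible unitary corepresentation: take a minimal invariant subspace, with the inner product
`π(a⋆ b)`, for which `Δ` is unitary since `π` is right invariant. -/
theorem exists_isIrreducible_isUnitary (hπ : IsHaarState π) {C : Submodule ℂ A} (hC : C ≠ ⊥)
    (hinv : ∀ a ∈ C, ∀ φ : A →ₗ[ℂ] ℂ, slice A φ (Coalgebra.comul (R := ℂ) a) ∈ C) :
    ∃ (m : ℕ) (κ : Corepresentation A (EuclideanSpace ℂ (Fin m)))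
      (T : EuclideanSpace ℂ (Fin m) →ₗ[ℂ] A), κ.IsIrreducible ∧ κ.IsUnitary ∧
        IsIntertwiner κ (regular A) T ∧ T ≠ 0 ∧ LinearMap.range T ≤ C := by
  obtain ⟨W, ⟨hW0, hWC, hWinv⟩, hmin⟩ := (wellFounded_lt (α := Submodule ℂ A)).has_min
    {W | W ≠ ⊥ ∧ W ≤ C ∧
      ∀ a ∈ W, ∀ φ : A →ₗ[ℂ] ℂ, slice A φ (Coalgebra.comul (R := ℂ) a) ∈ W} ⟨C, hC, le_rfl, hinv⟩
  obtain ⟨m, T, hTW, hT⟩ := hπ.exists_isometry_range_eq W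
  have hTinj : LinearMap.ker T = ⊥ := by
    rw [LinearMap.ker_eq_bot']
    intro v hv
    rw [← inner_self_eq_zero (𝕜 := ℂ), ← hT, hv, mul_zero, map_zero]
  obtain ⟨P, hPT⟩ := T.exists_leftInverse_of_injective hTinj
  have hTP : ∀ v, T.rTensor A (P.rTensor A (Coalgebra.comul (R := ℂ) (T v))) =
      Coalgebra.comul (R := ℂ) (T v) := by
    intro v
    obtain ⟨s, hs⟩ := mem_range_rTensor_subtype
      (hWinv (T v) (hTW ▸ LinearMap.mem_range_self T v))
    rw [← hs, ← LinearMap.comp_apply, ← LinearMap.comp_apply, ← LinearMap.rTensor_comp,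
      ← LinearMap.rTensor_comp]
    congr 2
    ext ⟨w, hw⟩
    rw [← hTW] at hw
    obtain ⟨u, rfl⟩ := hw
    simpa using congrArg T (LinearMap.congr_fun hPT u)
  let κ := (regular A).restrict T P hPT hTP
  have hκT : IsIntertwiner κ (regular A) T := fun v => (hTP v).symm
  refine ⟨m, κ, T, ⟨?_, ?_⟩, ?_, hκT, ?_, hTW ▸ hWC⟩
  -- `EuclideanSpace ℂ (Fin m)` is nonzero, its image under `T` being `W`.
  · by_contra h
    rw [not_nontrivial_iff_subsingleton] at h
    apply hW0
    rw [← hTW, LinearMap.range_eq_bot]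
    exact Subsingleton.elim _ _
  -- An invariant subspace is mapped by `T` to an invariant subspace of the minimal `W`.
  · intro X hX
    have hXinv : ∀ a ∈ X.map T, ∀ φ : A →ₗ[ℂ] ℂ,
        slice A φ (Coalgebra.comul (R := ℂ) a) ∈ X.map T := by
      rintro _ ⟨x, hx, rfl⟩ φ
      have : Coalgebra.comul (R := ℂ) (T x) = T.rTensor A (κ.map x) := hκT x
      rw [this, slice_rTensor]
      exact Submodule.mem_map_of_mem (slice_mem_of_mem_range_rTensor_subtype (hX x hx) φ)
    have hXW : X.map T ≤ W := hTW ▸ LinearMap.map_le_range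
    by_cases h0 : X.map T = ⊥
    · exact Or.inl (Submodule.map_injective_of_injective (LinearMap.ker_eq_bot.1 hTinj)
        (h0.trans (Submodule.map_bot T).symm))
    · right
      have h1 : X.map T = W := by
        by_contra hne
        exact hmin (X.map T) ⟨h0, hXW.trans hWC, hXinv⟩ (lt_of_le_of_ne hXW hne)
      apply Submodule.map_injective_of_injective (LinearMap.ker_eq_bot.1 hTinj)
      rw [h1, Submodule.map_top, hTW]
  · intro v u
    rw [innerA_eq_lslice hT, ← hκT v, ← hκT u]
    change lslice A π (star (Coalgebra.comul (R := ℂ) (T v)) * Coalgebra.comul (R := ℂ) (T u)) = _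
    rw [← FiniteQuantumGroup.comul_star, ← FiniteQuantumGroup.comul_mul, hπ.lslice_comul, hT]
  · rintro rfl
    exact hW0 (by rw [← hTW, LinearMap.range_zero])

variable {V : Type*} [NormedAddCommGroup V] [InnerProductSpace ℂ V] {n : Type*} [Fintype n]

theorem lslice_map_mem_span_coeff (κ : Corepresentation A V) (e : OrthonormalBasis n ℂ V)
    (φ : V →ₗ[ℂ] ℂ) (v : V) :
    lslice A φ (κ.map v) ∈ Submodule.span ℂ (Set.range fun p : n × n => κ.coeff e p.1 p.2) := by
  rw [← e.sum_repr v]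
  simp only [map_sum, map_smul, map_eq_sum_coeff, lslice_tmul]
  exact Submodule.sum_mem _ fun j _ => Submodule.smul_mem _ _ <| Submodule.sum_mem _ fun i _ =>
    Submodule.smul_mem _ _ (Submodule.subset_span ⟨(i, j), rfl⟩)

/-- The orthogonal complement of the coefficients of a unitary corepresentation is invariant for
`Δ`: right invariance gives `∑ₚ ρₚⱼ⋆ π(ρᵢₚ⋆ a₁) a₂ = π(ρᵢⱼ⋆ a) 1 = 0` for all `j`, and
unitarity removes the matrix `ρ⋆`. -/
theorem IsUnitary.haar_star_coeff_mul_slice [DecidableEq n] (hπ : IsHaarState π)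
    {κ : Corepresentation A V} (hκ : κ.IsUnitary) (e : OrthonormalBasis n ℂ V) {a : A}
    (ha : ∀ i j, π (star (κ.coeff e i j) * a) = 0) (φ : A →ₗ[ℂ] ℂ) (i j : n) :
    π (star (κ.coeff e i j) * slice A φ (Coalgebra.comul (R := ℂ) a)) = 0 := by
  set u := κ.coeff e with hu
  let X : A ⊗[ℂ] A → n → A := fun t p => lslice A (π ∘ₗ LinearMap.mulLeft ℂ (star (u i p))) t
  have h1 : ∀ (q : n) (t : A ⊗[ℂ] A), lslice A π (Coalgebra.comul (R := ℂ) (star (u i q)) * t) =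
      ∑ p, star (u p q) * X t p := by
    intro q t
    rw [FiniteQuantumGroup.comul_star, hu, κ.comul_coeff, ← hu, star_sum, Finset.sum_mul, map_sum]
    refine Finset.sum_congr rfl fun p _ => ?_
    induction t with
    | zero => simp [X]
    | add x y hx hy => simp only [mul_add, map_add, hx, hy, X]
    | tmul b c => simp [X]
  have h2 : X (Coalgebra.comul (R := ℂ) a) j = 0 := by
    calc X (Coalgebra.comul (R := ℂ) a) j
        = ∑ p, (u * u.conjTranspose) j p * X (Coalgebra.comul (R := ℂ) a) p := by
          rw [hκ.coeff_mul_conjTranspose]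
          simp [Matrix.one_apply]
      _ = ∑ q, u j q * lslice A π (Coalgebra.comul (R := ℂ) (star (u i q) * a)) := by
          simp only [FiniteQuantumGroup.comul_mul, h1, Matrix.mul_apply, Finset.sum_mul,
            Finset.mul_sum, mul_assoc, Matrix.conjTranspose_apply]
          exact Finset.sum_comm
      _ = 0 := by simp only [hπ.lslice_comul, ha, zero_smul, mul_zero, Finset.sum_const_zero]
  have h3 := apply_slice φ (π ∘ₗ LinearMap.mulLeft ℂ (star (u i j))) (Coalgebra.comul (R := ℂ) a)
  change π (star (u i j) * slice A φ (Coalgebra.comul (R := ℂ) a)) = φ (X _ j) at h3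
  rw [h3, h2, map_zero]

/-- The Peter–Weyl theorem: the coefficients of the irreducible corepresentations span `A`.
Otherwise the orthogonal complement `C` of their span `U` contains an irreducible subcorepresentation
`W` of `Δ`. It is equivalent to some `κ α`, whose coefficients lie in `U`, so that
`w = (ε ⊗ I)Δ(w)` lies in `U ∩ C = 0` for `w ∈ W`. -/
theorem IsIrr.span_coeff_eq_top (hπ : IsHaarState π) {ι : Type*} {V : ι → Type*}
    [∀ α, NormedAddCommGroup (V α)] [∀ α, InnerProductSpace ℂ (V α)]
    {κ : ∀ α, Corepresentation A (V α)} (hκ : IsIrr κ) {n : ι → Type*} [∀ α, Fintype (n α)]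
    (e : ∀ α, OrthonormalBasis (n α) ℂ (V α)) :
    Submodule.span ℂ (Set.range fun p : Σ α, n α × n α => (κ p.1).coeff (e p.1) p.2.1 p.2.2) =
      ⊤ := by
  classical
  set U := Submodule.span ℂ
    (Set.range fun p : Σ α, n α × n α => (κ p.1).coeff (e p.1) p.2.1 p.2.2) with hU
  let C : Submodule ℂ A := ⨅ p : Σ α, n α × n α,
    LinearMap.ker (π ∘ₗ LinearMap.mulLeft ℂ (star ((κ p.1).coeff (e p.1) p.2.1 p.2.2)))
  have hC : ∀ a, a ∈ C ↔ ∀ α i j, π (star ((κ α).coeff (e α) i j) * a) = 0 := by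
    intro a
    simp [C, Submodule.mem_iInf, Sigma.forall]
  have horth : ∀ u ∈ U, ∀ a ∈ C, π (star u * a) = 0 := by
    intro u hu a ha
    induction hu using Submodule.span_induction with
    | mem x hx => obtain ⟨⟨α, i, j⟩, rfl⟩ := hx; exact (hC a).1 ha α i j
    | zero => simp
    | add x y _ _ hx hy => rw [star_add, add_mul, map_add, hx, hy, add_zero]
    | smul c x _ hx => rw [star_smul, smul_mul_assoc, map_smul, hx, smul_zero]
  have hCbot : C = ⊥ := by
    by_contra hne
    obtain ⟨m, κ₀, T, hirr, hunit, hT, hT0, hTC⟩ := exists_isIrreducible_isUnitary hπ hne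
      fun a ha φ => (hC _).2 fun α =>
        (hκ.unitary α).haar_star_coeff_mul_slice hπ (e α) ((hC a).1 ha α) φ
    obtain ⟨α, S, hS⟩ := hκ.exhaustive m κ₀ hirr hunit
    apply hT0
    ext1 w
    refine hπ.faithful _ (horth _ ?_ _ (hTC (LinearMap.mem_range_self T w)))
    obtain ⟨v, rfl⟩ := S.surjective w
    have h1 : T (S v) = lslice A ((Coalgebra.counit ∘ₗ T) ∘ₗ S.toLinearMap) ((κ α).map v) := by
      rw [← lslice_rTensor, ← hS, ← lslice_rTensor, ← hT]
      exact (lslice_counit_comul _).symm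
    rw [h1]
    refine Submodule.span_mono ?_ (lslice_map_mem_span_coeff (κ α) (e α) _ v)
    rintro _ ⟨p, rfl⟩
    exact ⟨⟨α, p⟩, rfl⟩
  obtain ⟨n, Φ, hΦ⟩ := hπ.isState.exists_linearEquiv_euclideanSpace hπ.faithful
  have h2 : (U.map Φ.toLinearMap)ᗮ = ⊥ := by
    rw [Submodule.eq_bot_iff]
    intro x hx
    have hx' : Φ.symm x ∈ C := (hC _).2 fun α i j => by
      rw [← hΦ, Φ.apply_symm_apply]
      exact (Submodule.mem_orthogonal _ _).1 hx _
        (Submodule.mem_map_of_mem (Submodule.subset_span ⟨⟨α, i, j⟩, rfl⟩))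
    rw [hCbot, Submodule.mem_bot] at hx'
    simpa using hx'
  rw [Submodule.orthogonal_eq_bot_iff] at h2
  apply Submodule.map_injective_of_injective Φ.injective
  exact h2.trans (by rw [Submodule.map_top]; exact Φ.range.symm)

end PeterWeyl

end Corepresentation

/-! ### The one-norm and convolution powers -/

section OneNorm
variable {A : Type*} [CStarAlgebra A]

/-- The Cauchy–Schwarz inequality `φ(|a|)² ≤ φ(|a|²)`, by positivity of `φ` on `(|a| - φ(|a|) 1)²`. -/
theorem IsState.oneNorm_sq_le {φ : A →ₗ[ℂ] ℂ} (hφ : IsState φ) (a : A) :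
    oneNorm φ a ^ 2 ≤ (φ (star a * a)).re := by
  set x := star a * a with hx
  set s := cfc Real.sqrt x with hs
  have hss : s * s = x := by
    rw [hs, ← cfc_mul Real.sqrt Real.sqrt x]
    conv_rhs => rw [← cfc_id' ℝ x (IsSelfAdjoint.star_mul_self a)]
    exact cfc_congr fun r hr => Real.mul_self_sqrt (spectrum_star_mul_self_nonneg r hr)
  have hsa : star s = s := cfc_predicate Real.sqrt x
  have h := (Complex.nonneg_iff.1 (hφ.nonneg (s - ((φ s).re : ℂ) • (1 : A)))).1
  rw [star_sub, star_smul, star_one, hsa, sub_mul, mul_sub, mul_sub, hss] at h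
  simp [hφ.map_one] at h
  change (φ s).re ^ 2 ≤ _
  nlinarith

theorem vanDaele_invFun {π : A →ₗ[ℂ] ℂ} (h : Function.Surjective (vanDaele π)) (μ : A →ₗ[ℂ] ℂ)
    (b : A) : π (b * Function.invFun (vanDaele π) μ) = μ b :=
  LinearMap.congr_fun (Function.invFun_eq (h μ)) b

end OneNorm

section ConvPow
variable {A : Type*} [CStarAlgebra A] [FiniteQuantumGroup A]

/-- The counit is a character of a C⋆-algebra, hence preserves the involution. -/
theorem counit_star (a : A) :
    Coalgebra.counit (R := ℂ) (star a) = conj (Coalgebra.counit (R := ℂ) a) :=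
  map_star (Bialgebra.counitAlgHom ℂ A) a

theorem convPow_succ (ν : A →ₗ[ℂ] ℂ) (k : ℕ) : convPow ν (k + 1) = conv (convPow ν k) ν := rfl

theorem convPow_one {ν : A →ₗ[ℂ] ℂ} (hν : ν 1 = 1) (k : ℕ) : convPow ν k 1 = 1 := by
  induction k with
  | zero => exact FiniteQuantumGroup.counit_one
  | succ k ih =>
    rw [convPow_succ, conv_apply_eq_slice, FiniteQuantumGroup.comul_one,
      Algebra.TensorProduct.one_def, slice_tmul, hν, one_smul, ih]

end ConvPow

/-! ### The Fourier transform in coordinates -/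

section ConjBasis
variable {V : Type*} [NormedAddCommGroup V] [InnerProductSpace ℂ V] {n : Type*} [Fintype n]

theorem inner_toConj (u v : V) : ⟪toConj V u, toConj V v⟫_ℂ = ⟪v, u⟫_ℂ := rfl

/-- The orthonormal basis `ēᵢ` of `V̄` conjugate to an orthonormal basis `eᵢ` of `V`. -/
def conjBasis (e : OrthonormalBasis n ℂ V) : OrthonormalBasis n ℂ (ConjSpace V) :=
  OrthonormalBasis.mk (v := fun i => toConj V (e i))
    (by
      classical
      rw [orthonormal_iff_ite]
      intro i j
      rw [inner_toConj, orthonormal_iff_ite.1 e.orthonormal]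
      simp [eq_comm])
    (by
      rintro x -
      obtain ⟨v, rfl⟩ := (toConj V).surjective x
      rw [← e.sum_repr v, map_sum]
      refine Submodule.sum_mem _ fun i _ => ?_
      rw [map_smulₛₗ]
      exact Submodule.smul_mem _ _ (Submodule.subset_span ⟨i, rfl⟩))

@[simp] theorem conjBasis_apply (e : OrthonormalBasis n ℂ V) (i : n) :
    conjBasis e i = toConj V (e i) := by simp [conjBasis]

end ConjBasis

namespace Corepresentation
variable {A : Type*} [CStarAlgebra A] [FiniteQuantumGroup A]

section Fourier
variable {V : Type*} [NormedAddCommGroup V] [InnerProductSpace ℂ V] {n : Type*} [Fintype n]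

/-- The matrix of `ν̂(κ)ᵏ` in the basis `ēᵢ` has entries `ν^{⋆ k}(ρᵢⱼ⋆)`. -/
theorem fourier_pow_apply [DecidableEq n] (κ : Corepresentation A V) (e : OrthonormalBasis n ℂ V)
    (ν : A →ₗ[ℂ] ℂ) (k : ℕ) (j : n) :
    (κ.fourier ν ^ k) (conjBasis e j) =
      ∑ i, convPow ν k (star (κ.coeff e i j)) • conjBasis e i := by
  induction k generalizing j with
  | zero =>
    have h : ∀ i, convPow ν 0 (star (κ.coeff e i j)) = if i = j then 1 else 0 := fun i => by
      change Coalgebra.counit (R := ℂ) _ = _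
      rw [counit_star, κ.counit_coeff]
      split_ifs <;> simp
    simp [h]
  | succ k ih =>
    have h : κ.fourier ν (conjBasis e j) =
        ∑ p, ν (star (κ.coeff e p j)) • conjBasis e p := by
      rw [conjBasis_apply]
      change slice (ConjSpace V) ν (TensorProduct.map _ _ (κ.map (e j))) = _
      rw [map_eq_sum_coeff κ e j]
      simp
    rw [pow_succ, Module.End.mul_apply, h]
    simp only [map_sum, map_smul, ih, Finset.smul_sum, smul_smul]
    rw [Finset.sum_comm]
    refine Finset.sum_congr rfl fun i _ => ?_
    rw [← Finset.sum_smul, convPow_succ, conv_apply_eq_slice, FiniteQuantumGroup.comul_star,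
      κ.comul_coeff, star_sum, map_sum, map_sum]
    simp

/-- `Tr((ν̂⋆)ᵏ ν̂ᵏ)` is the squared Hilbert–Schmidt norm of `ν̂ᵏ`. -/
theorem re_trace_fourier_pow [FiniteDimensional ℂ V] (κ : Corepresentation A V)
    (e : OrthonormalBasis n ℂ V) (ν : A →ₗ[ℂ] ℂ) (k : ℕ) :
    (LinearMap.trace ℂ (ConjSpace V)
      (LinearMap.adjoint (κ.fourier ν) ^ k * κ.fourier ν ^ k)).re =
      ∑ p : n × n, ‖convPow ν k (star (κ.coeff e p.1 p.2))‖ ^ 2 := by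
  classical
  have h1 : LinearMap.adjoint (κ.fourier ν) ^ k = LinearMap.adjoint (κ.fourier ν ^ k) := by
    rw [← LinearMap.star_eq_adjoint, ← LinearMap.star_eq_adjoint, star_pow]
  rw [LinearMap.trace_eq_sum_inner _ (conjBasis e), Complex.re_sum, Fintype.sum_prod_type_right]
  refine Finset.sum_congr rfl fun j _ => ?_
  rw [h1, Module.End.mul_apply, LinearMap.adjoint_inner_right, fourier_pow_apply,
    (conjBasis e).orthonormal.inner_sum, Complex.re_sum]
  refine Finset.sum_congr rfl fun i _ => ?_
  rw [← Complex.normSq_eq_conj_mul_self, Complex.ofReal_re, Complex.normSq_eq_norm_sq]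

theorem trivial_isIrreducible : (trivial A).IsIrreducible :=
  ⟨inferInstance, fun W _ => eq_bot_or_eq_top W⟩

/-- The Haar state annihilates the coefficients of nontrivial irreducible corepresentations: they are
orthogonal to the coefficient `1` of the trivial one. -/
theorem haar_star_coeff_of_not_equivalent_trivial {π : A →ₗ[ℂ] ℂ} (hπ : IsHaarState π)
    {κ : Corepresentation A V} (hκ : κ.IsIrreducible) (hu : κ.IsUnitary)
    (h : ¬ κ.Equivalent (trivial A)) (e : OrthonormalBasis n ℂ V) (i j : n) :
    π (star (κ.coeff e i j)) = 0 := by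
  have h1 := haar_star_coeff_mul_coeff_of_not_equivalent hπ trivial_isIrreducible hκ hu
    (fun h' => h h'.symm) (OrthonormalBasis.singleton (Fin 1) ℂ) e i j 0 0
  have h2 : (trivial A).coeff (OrthonormalBasis.singleton (Fin 1) ℂ) 0 0 = 1 := by
    simp [coeff, trivial]
  rwa [h2, mul_one] at h1

/-- The coefficients of a corepresentation equivalent to the trivial one are scalars. -/
theorem apply_star_coeff_of_equivalent_trivial {κ : Corepresentation A V}
    (h : κ.Equivalent (trivial A)) (e : OrthonormalBasis n ℂ V) {f : A →ₗ[ℂ] ℂ} (hf : f 1 = 0)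
    (i j : n) : f (star (κ.coeff e i j)) = 0 := by
  obtain ⟨T, hT⟩ := h.symm
  have h1 := hT (T.symm (e j))
  rw [T.apply_symm_apply] at h1
  have h2 : κ.coeff e i j = ⟪e i, e j⟫_ℂ • (1 : A) := by
    rw [coeff, h1]
    simp [trivial]
  rw [h2, star_smul, star_one, map_smul, hf, smul_zero]

end Fourier

/-! ### The Plancherel formula -/

section Plancherel
variable {π : A →ₗ[ℂ] ℂ} {ι : Type*} {V : ι → Type*} [∀ α, NormedAddCommGroup (V α)]
  [∀ α, InnerProductSpace ℂ (V α)] {κ : ∀ α, Corepresentation A (V α)} {n : ι → Type*}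
  [∀ α, Fintype (n α)]

/-- The Schur orthogonality relations for a complete family of irreducible corepresentations. -/
theorem IsIrr.haar_star_coeff_mul_coeff [∀ α, DecidableEq (n α)] [DecidableEq (Σ α, n α × n α)]
    (hπ : IsHaarState π) (hκ : IsIrr κ) (e : ∀ α, OrthonormalBasis (n α) ℂ (V α))
    (p q : Σ α, n α × n α) :
    π (star ((κ p.1).coeff (e p.1) p.2.1 p.2.2) * (κ q.1).coeff (e q.1) q.2.1 q.2.2) =
      if p = q then (Fintype.card (n p.1) : ℂ)⁻¹ else 0 := by
  obtain ⟨α, k, i⟩ := p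
  obtain ⟨β, l, j⟩ := q
  by_cases hαβ : α = β
  · subst hαβ
    rw [Corepresentation.haar_star_coeff_mul_coeff hπ (hκ.irreducible α) (hκ.unitary α)]
    simp
  · rw [haar_star_coeff_mul_coeff_of_not_equivalent hπ (hκ.irreducible β) (hκ.irreducible α)
      (hκ.unitary α) fun h => hαβ (hκ.inequivalent β α h).symm]
    simp [hαβ]

theorem IsIrr.card_pos (hκ : IsIrr κ) (e : ∀ α, OrthonormalBasis (n α) ℂ (V α)) (α : ι) :
    0 < Fintype.card (n α) := by
  have := (hκ.irreducible α).1
  have := (e α).toBasis.index_nonempty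
  exact Fintype.card_pos

/-- The coefficients `√d_α ρᵢⱼ`, for all `α`, are orthonormal for `π(a⋆ b)`. -/
theorem IsIrr.orthonormal (hπ : IsHaarState π) (hκ : IsIrr κ)
    (e : ∀ α, OrthonormalBasis (n α) ℂ (V α)) {m : ℕ} (Φ : A ≃ₗ[ℂ] EuclideanSpace ℂ (Fin m))
    (hΦ : ∀ a b, ⟪Φ a, Φ b⟫_ℂ = π (star a * b)) :
    Orthonormal ℂ fun p : Σ α, n α × n α =>
      (√(Fintype.card (n p.1)) : ℂ) • Φ ((κ p.1).coeff (e p.1) p.2.1 p.2.2) := by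
  classical
  rw [orthonormal_iff_ite]
  intro p q
  rw [inner_smul_left, inner_smul_right, hΦ, hκ.haar_star_coeff_mul_coeff hπ e p q]
  split_ifs with h
  · subst h
    have hd : (Fintype.card (n p.1) : ℂ) ≠ 0 := by exact_mod_cast (hκ.card_pos e p.1).ne'
    rw [Complex.conj_ofReal, ← mul_assoc, ← Complex.ofReal_mul,
      Real.mul_self_sqrt (Nat.cast_nonneg _), Complex.ofReal_natCast, mul_inv_cancel₀ hd]
  · simp

theorem IsIrr.finite (hπ : IsHaarState π) (hκ : IsIrr κ)
    (e : ∀ α, OrthonormalBasis (n α) ℂ (V α)) : Finite ι := by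
  obtain ⟨m, Φ, hΦ⟩ := hπ.isState.exists_linearEquiv_euclideanSpace hπ.faithful
  have : Finite (Σ α, n α × n α) := (hκ.orthonormal hπ e Φ hΦ).linearIndependent.finite
  have (α : ι) : Nonempty (n α × n α) := by
    have := Fintype.card_pos_iff.1 (hκ.card_pos e α)
    infer_instance
  exact Finite.of_surjective (Sigma.fst : (Σ α, n α × n α) → ι) fun α =>
    ⟨⟨α, Classical.arbitrary _⟩, rfl⟩

/-- The Plancherel formula: Parseval's identity for the orthonormal basis `√d_α ρᵢⱼ`. -/
theorem IsIrr.plancherel [Fintype ι] (hπ : IsHaarState π) (hκ : IsIrr κ)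
    (e : ∀ α, OrthonormalBasis (n α) ℂ (V α)) (a : A) :
    (π (star a * a)).re = ∑ α, (Fintype.card (n α) : ℝ) *
      ∑ p : n α × n α, ‖π (star ((κ α).coeff (e α) p.1 p.2) * a)‖ ^ 2 := by
  obtain ⟨m, Φ, hΦ⟩ := hπ.isState.exists_linearEquiv_euclideanSpace hπ.faithful
  have hspan : ⊤ ≤ Submodule.span ℂ (Set.range fun p : Σ α, n α × n α =>
      (√(Fintype.card (n p.1)) : ℂ) • Φ ((κ p.1).coeff (e p.1) p.2.1 p.2.2)) := by
    rw [← Φ.range, ← Submodule.map_top, ← hκ.span_coeff_eq_top hπ e, Submodule.map_span,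
      Submodule.span_le]
    rintro _ ⟨_, ⟨p, rfl⟩, rfl⟩
    have hd : (√(Fintype.card (n p.1)) : ℂ) ≠ 0 := by
      have := hκ.card_pos e p.1
      exact_mod_cast (Real.sqrt_pos.2 (Nat.cast_pos.2 this)).ne'
    rw [SetLike.mem_coe, ← Submodule.smul_mem_iff _ hd]
    exact Submodule.subset_span ⟨p, rfl⟩
  let b := OrthonormalBasis.mk (hκ.orthonormal hπ e Φ hΦ) hspan
  have h1 : (π (star a * a)).re = ‖Φ a‖ ^ 2 := by
    rw [← hΦ, inner_self_eq_norm_sq_to_K]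
    norm_cast
  rw [h1, ← b.sum_sq_norm_inner_right, Fintype.sum_sigma]
  refine Finset.sum_congr rfl fun α _ => ?_
  rw [Finset.mul_sum]
  refine Finset.sum_congr rfl fun p _ => ?_
  simp only [b, OrthonormalBasis.coe_mk]
  rw [inner_smul_left, hΦ, norm_mul, mul_pow, RCLike.norm_conj, Complex.norm_real,
    Real.norm_of_nonneg (Real.sqrt_nonneg _), Real.sq_sqrt (Nat.cast_nonneg _)]

end Plancherel

end Corepresentation
end FiniteQuantumGroup

end

open FiniteQuantumGroup Corepresentation in
theorem mainTheorem1 {A : Type*} [CStarAlgebra A] [FiniteQuantumGroup A]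
    (π : A →ₗ[ℂ] ℂ) (hπ : FiniteQuantumGroup.IsHaarState π)
    {ι : Type*} (V : ι → Type*) [∀ α, NormedAddCommGroup (V α)]
    [∀ α, InnerProductSpace ℂ (V α)] [∀ α, FiniteDimensional ℂ (V α)]
    (κ : ∀ α, FiniteQuantumGroup.Corepresentation A (V α))
    (hκ : FiniteQuantumGroup.Corepresentation.IsIrr κ)
    (ν : A →ₗ[ℂ] ℂ) (hν : FiniteQuantumGroup.IsState ν) (k : ℕ) :
    Function.Bijective (FiniteQuantumGroup.vanDaele π) ∧ Finite ι ∧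
    FiniteQuantumGroup.totalVariation (FiniteQuantumGroup.convPow ν k) π ^ 2 ≤
      1 / 4 * ∑ᶠ (α : ι)
        (_ : ¬ (κ α).Equivalent (FiniteQuantumGroup.Corepresentation.trivial A)),
        (Module.finrank ℂ (V α) : ℝ) *
          (LinearMap.trace ℂ (FiniteQuantumGroup.ConjSpace (V α))
            (LinearMap.adjoint ((κ α).fourier ν) ^ k * (κ α).fourier ν ^ k)).re := by
  have hbij := hπ.bijective_vanDaele
  let e := fun α => stdOrthonormalBasis ℂ (V α)
  have hfin : Finite ι := hκ.finite hπ e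
  refine ⟨hbij, hfin, ?_⟩
  have := Fintype.ofFinite ι
  set f := convPow ν k - π with hf
  set a := Function.invFun (vanDaele π) f with ha
  have hfa : ∀ b, π (b * a) = f b := vanDaele_invFun hbij.2 f
  have hf1 : f 1 = 0 := by
    rw [hf, LinearMap.sub_apply, convPow_one hν.map_one, hπ.isState.map_one, sub_self]
  have h1 : totalVariation (convPow ν k) π ^ 2 ≤ 1 / 4 * (π (star a * a)).re := by
    have := hπ.isState.oneNorm_sq_le a
    change (1 / 2 * oneNorm π a) ^ 2 ≤ _
    nlinarith
  refine h1.trans (le_of_eq ?_)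
  -- The rest is an equality: `a` has Fourier coefficients `π(ρᵢⱼ⋆ a) = f(ρᵢⱼ⋆)`.
  rw [hκ.plancherel hπ e a, finsum_eq_sum_of_fintype]
  congr 1
  refine Finset.sum_congr rfl fun α _ => ?_
  classical
  rw [finsum_eq_if, Fintype.card_fin]
  split_ifs with h
  · simp [hfa, apply_star_coeff_of_equivalent_trivial h (e α) hf1]
  · rw [re_trace_fourier_pow (κ α) (e α)]
    congr 1
    refine Finset.sum_congr rfl fun p _ => ?_
    rw [hfa, hf, LinearMap.sub_apply, haar_star_coeff_of_not_equivalent_trivial hπ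
      (hκ.irreducible α) (hκ.unitary α) h, sub_zero]
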